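/- Consider a two-color urn with replacement matrix $R=\begin{pmatrix}a&b\\c&d\end{pmatrix}$, where $a,b,c,d$ are nonnegative integers: when a red ball is drawn it is put back together with $a$ red and $b$ black balls, when a black ball is drawn it is put back together with $c$ red and $d$ black balls. Assume that the urn is balanced, $S:=a+b=c+d$, that $R$ is not triangular, $bc\neq 0$, and that the urn is large, that is, $\sigma:=m/S>\frac12$ where $m:=a-c$. Put $u_2(x,y)=\frac1S(bx-cy)$, and let $(\alpha,\beta)\in\mathbb{N}^2\setminus\{(0,0)\}$ be any initial composition ($\alpha$ red and $\beta$ black balls). Let $(U^{DT}_{(\alpha,\beta)}(n))_{n\in\mathbb{N}}$ be the discrete-time composition process started from $(\alpha,\beta)$ (at each step one ball is drawn uniformly at random, independently of the past given the current composition), and let $(U^{CT}_{(\alpha,\beta)}(t))_{t\ge0}$ be the continuous-time composition process started from $(\alpha,\beta)$ (at any moment each ball in the urn carries an exponential clock of parameter $1$, all the clocks being independent of each other and of the past; when the clock of a ball rings, balls are added by the same replacement rule). Then the limits $$W^{DT}_{(\alpha,\beta)}=\lim_{n\to\infty}n^{-\sigma}\,u_2\big(U^{DT}_{(\alpha,\beta)}(n)\big),\qquad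 W^{CT}_{(\alpha,\beta)}=\lim_{t\to+\infty}e^{-mt}\,u_2\big(U^{CT}_{(\alpha,\beta)}(t)\big)$$ exist almost surely, and the law of $W^{DT}_{(\alpha,\beta)}$ and the law of $W^{CT}_{(\alpha,\beta)}$ are both determined by their moments: each has finite moments of all orders and is the only probability measure on $\mathbb{R}$ with these moments. -/

import Mathlib

open MeasureTheory ProbabilityTheory Filter Topology
open scoped NNReal

namespace PolyaUrn

/-!
The two-colour urn with replacement matrix `(a b; c d)`: a drawn red ball is put back together with
`a` red and `b` black balls, a drawn black ball together with `c` red and `d` black balls.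
A composition is a pair (number of red balls, number of black balls). The urns considered are
balanced, with balance `S = a + b = c + d`.
-/

/-- The ratio `σ = m / S` of the eigenvalues `m = a - c` and `S = a + b`. -/
noncomputable def ratio (a b c : ℕ) : ℝ := ((a : ℝ) - c) / ((a : ℝ) + b)

/-- The eigenform `u₂(x, y) = (b x - c y) / S`, with `S = a + b`. -/
noncomputable def u₂ (a b c : ℕ) (v : ℕ × ℕ) : ℝ :=
  ((b : ℝ) * v.1 - (c : ℝ) * v.2) / ((a : ℝ) + b)

/-- The probability to go from composition `v` to composition `w` by drawing a ball uniformly at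
random and applying the replacement rule. -/
noncomputable def stepProb (a b c d : ℕ) (v w : ℕ × ℕ) : ℝ :=
  (v.1 : ℝ) / ((v.1 : ℝ) + v.2) * (if w = v + (a, b) then 1 else 0) +
    (v.2 : ℝ) / ((v.1 : ℝ) + v.2) * (if w = v + (c, d) then 1 else 0)

/-- `U` is (a version of) the discrete-time urn process with initial composition `(α, β)`:
the Markov chain on compositions started at `(α, β)` with transition probabilities `stepProb`. -/
structure IsDiscreteTimeUrn {Ω : Type*} [MeasurableSpace Ω] (P : Measure Ω)
    (a b c d α β : ℕ) (U : ℕ → Ω → ℕ × ℕ) : Prop where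
  measurable : ∀ n, Measurable (U n)
  initial : ∀ᵐ ω ∂P, U 0 ω = (α, β)
  markov : ∀ (n : ℕ) (u : ℕ → ℕ × ℕ),
    P.real {ω | ∀ k ≤ n + 1, U k ω = u k} =
      P.real {ω | ∀ k ≤ n, U k ω = u k} * stepProb a b c d (u n) (u (n + 1))

/-- Data realizing the continuous-time urn. Here `τ n` is the time of the `n`-th ring, `V n` is the
composition just after it and `ℱ n` is the information available at that time. Between the `n`-th
and the next ring there are `α + β + n S` balls, the first `(V n).1` of which are taken to be the
red ones; `E n j` is the time that the clock of ball `j` still has to run, counted from `τ n`.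
At every such moment the clocks are independent, exponentially distributed with parameter `1`,
and independent of the past. The ball whose clock rings first determines the replacement. -/
structure IsClockedUrn {Ω : Type*} [mΩ : MeasurableSpace Ω] (P : Measure Ω)
    (a b c d α β : ℕ) (ℱ : Filtration ℕ mΩ) (V : ℕ → Ω → ℕ × ℕ) (τ : ℕ → Ω → ℝ)
    (E : ∀ n : ℕ, Fin (α + β + n * (a + b)) → Ω → ℝ) : Prop where
  measurable_V : ∀ n, Measurable[ℱ n] (V n)
  measurable_τ : ∀ n, Measurable[ℱ n] (τ n)
  measurable_E : ∀ n j, Measurable (E n j)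
  initial_V : ∀ᵐ ω ∂P, V 0 ω = (α, β)
  initial_τ : ∀ᵐ ω ∂P, τ 0 ω = 0
  clocks_exp : ∀ n j, P.map (E n j) = expMeasure 1
  clocks_indep : ∀ n, iIndepFun (E n) P
  clocks_indep_past : ∀ n,
    Indep (MeasurableSpace.comap (fun ω j => E n j ω) MeasurableSpace.pi) (ℱ n) P
  ring : ∀ᵐ ω ∂P, ∀ n, ∃ j, (∀ i, E n j ω ≤ E n i ω) ∧ τ (n + 1) ω = τ n ω + E n j ω ∧
    V (n + 1) ω = V n ω + if (j : ℕ) < (V n ω).1 then (a, b) else (c, d)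

/-- `U` is (a version of) the continuous-time urn process with initial composition `(α, β)`: the
composition at time `t` is the one just after the last ring before or at `t`. -/
def IsContinuousTimeUrn {Ω : Type*} [mΩ : MeasurableSpace Ω] (P : Measure Ω)
    (a b c d α β : ℕ) (U : ℝ≥0 → Ω → ℕ × ℕ) : Prop :=
  ∃ (ℱ : Filtration ℕ mΩ) (V : ℕ → Ω → ℕ × ℕ) (τ : ℕ → Ω → ℝ)
    (E : ∀ n : ℕ, Fin (α + β + n * (a + b)) → Ω → ℝ),
    IsClockedUrn P a b c d α β ℱ V τ E ∧
      ∀ᵐ ω ∂P, ∀ (t : ℝ≥0) (n : ℕ), τ n ω ≤ t → (t : ℝ) < τ (n + 1) ω → U t ω = V n ω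

/-- `W` is a version of the almost sure limit `lim n ^ (-σ) u₂(U n)`. -/
def IsDiscreteTimeLimit {Ω : Type*} [MeasurableSpace Ω] (P : Measure Ω)
    (a b c : ℕ) (U : ℕ → Ω → ℕ × ℕ) (W : Ω → ℝ) : Prop :=
  Measurable W ∧ ∀ᵐ ω ∂P,
    Tendsto (fun n : ℕ => 1 / (n : ℝ) ^ ratio a b c * u₂ a b c (U n ω)) atTop (𝓝 (W ω))

/-- `W` is a version of the almost sure limit `lim e ^ (-m t) u₂(U t)`, where `m = a - c`. -/
def IsContinuousTimeLimit {Ω : Type*} [MeasurableSpace Ω] (P : Measure Ω)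
    (a b c : ℕ) (U : ℝ≥0 → Ω → ℕ × ℕ) (W : Ω → ℝ) : Prop :=
  Measurable W ∧ ∀ᵐ ω ∂P,
    Tendsto (fun t : ℝ≥0 => Real.exp (-((a : ℝ) - c) * t) * u₂ a b c (U t ω)) atTop (𝓝 (W ω))

/-- A law on the real line is determined by its moments: it has finite moments of all orders, and
it is the only probability measure with these moments. -/
def IsDeterminedByMoments (ν : Measure ℝ) : Prop :=
  (∀ k : ℕ, Integrable (fun x : ℝ => x ^ k) ν) ∧
    ∀ ν' : Measure ℝ, IsProbabilityMeasure ν' →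
      (∀ k : ℕ, Integrable (fun x : ℝ => x ^ k) ν') →
      (∀ k : ℕ, ∫ x, x ^ k ∂ν' = ∫ x, x ^ k ∂ν) → ν' = ν

end PolyaUrn

/-!
Both limits have tails thin enough to give exponential moments, and a law with exponential moments
is determined by its moments.

In discrete time, `u₂` is an eigenfunction of the one-step mean, so `u₂(U n)` divided by its mean
growth factor, which is of order `n ^ σ`, is a martingale. Its value at time `n` is of order at most
`n ^ (1 - σ)` and its increments are of order at most `n ^ (-σ)`. Since `σ > 1/2` the squared
increments after time `N` sum to order `N ^ (1 - 2σ)`, and the Chernoff bound with parameter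
`N ^ σ`, which trades the deterministic bound up to time `N` against the increments after it, shows
`P(|W| > K N ^ (1 - σ)) ≤ 2 e ^ (-N)`.

In continuous time, the composition just after the `n`-th ring is a discrete-time urn. If `T_n` is
the number of balls at that moment, the waiting time for the next ring is exponential with parameter
`T_n` and independent of the past, so that `T_n e ^ (-S τ_n)` is a martingale; its `k`-th moments
are explicit and at most `(K k) ^ k`, so that its limit `ξ` satisfies `P(ξ > K N) ≤ e ^ (-N)`. Hence
`n e ^ (-S τ_n)` tends to `ξ / S`, and `W^CT = (ξ / S) ^ σ W^DT`. The tail exponents `σ` and `1 - σ`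
of the two factors add up to `1`, which is what exponential moments require.
-/

namespace PolyaUrn

section Moments

variable {ν : Measure ℝ}

theorem lintegral_cosh_eq_tsum_moments (hint : ∀ k : ℕ, Integrable (fun x : ℝ => x ^ k) ν) (t : ℝ) :
    ∫⁻ x, ENNReal.ofReal (Real.cosh (t * x)) ∂ν =
      ∑' k : ℕ, ENNReal.ofReal (t ^ (2 * k) / (2 * k).factorial * ∫ x, x ^ (2 * k) ∂ν) := by
  have hseries (x : ℝ) : ENNReal.ofReal (Real.cosh (t * x)) =
      ∑' k : ℕ, ENNReal.ofReal (t ^ (2 * k) / (2 * k).factorial * x ^ (2 * k)) := by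
    have hsum := Real.hasSum_cosh (t * x)
    rw [← hsum.tsum_eq, ENNReal.ofReal_tsum_of_nonneg (fun k => by rw [pow_mul]; positivity)
      hsum.summable]
    exact tsum_congr fun k => by rw [mul_pow, mul_div_right_comm]
  simp_rw [hseries]
  rw [lintegral_tsum fun k => by fun_prop]
  refine tsum_congr fun k => ?_
  rw [← integral_const_mul, ofReal_integral_eq_lintegral_ofReal ((hint _).const_mul _)]
  refine ae_of_all _ fun x => ?_
  simp only [Pi.zero_apply, pow_mul]
  positivity

theorem integrable_cosh_mul_iff {t : ℝ} :
    Integrable (fun x => Real.cosh (t * x)) ν ↔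
      ∫⁻ x, ENNReal.ofReal (Real.cosh (t * x)) ∂ν < ⊤ := by
  rw [← hasFiniteIntegral_iff_ofReal (ae_of_all _ fun _ => (Real.cosh_pos _).le)]
  exact ⟨fun h => h.2, fun h => ⟨Measurable.aestronglyMeasurable (by fun_prop), h⟩⟩

theorem integrable_exp_mul_of_integrable_cosh_mul {t : ℝ}
    (h : Integrable (fun x => Real.cosh (t * x)) ν) :
    Integrable (fun x => Real.exp (t * x)) ν := by
  refine (h.const_mul 2).mono' (by fun_prop) (ae_of_all _ fun x => ?_)
  rw [Real.norm_eq_abs, abs_of_pos (Real.exp_pos _), Real.cosh_eq]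
  linarith [Real.exp_pos (-(t * x))]

theorem zero_mem_interior_integrableExpSet_iff :
    0 ∈ interior (integrableExpSet id ν) ↔
      ∃ ε > 0, Integrable (fun x => Real.cosh (ε * x)) ν := by
  constructor
  · intro h
    obtain ⟨ε, hε, hball⟩ := Metric.isOpen_iff.1 isOpen_interior 0 h
    have hexp {s : ℝ} (hs : |s| < ε) : Integrable (fun x => Real.exp (s * x)) ν :=
      (interior_subset (hball (by simpa using hs)) : s ∈ integrableExpSet id ν)
    have hhalf : |ε / 2| < ε := by rw [abs_of_pos (half_pos hε)]; exact half_lt_self hε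
    refine ⟨ε / 2, half_pos hε,
      (((hexp hhalf).add (hexp (abs_neg (ε / 2) ▸ hhalf))).div_const 2).congr
        (ae_of_all _ fun x => ?_)⟩
    simp [Real.cosh_eq]
  · rintro ⟨ε, hε, h⟩
    have hneg : Integrable (fun x => Real.exp (-ε * x)) ν :=
      integrable_exp_mul_of_integrable_cosh_mul (by simpa using h)
    refine mem_interior.2 ⟨Set.Ioo (-ε) ε, fun t ht => ?_, isOpen_Ioo, by simpa using hε⟩
    exact integrable_exp_mul_of_le_of_le hneg (integrable_exp_mul_of_integrable_cosh_mul h)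
      ht.1.le ht.2.le

theorem complexMGF_eventuallyEq_of_moments_eq {ν' : Measure ℝ}
    (hν : 0 ∈ interior (integrableExpSet id ν)) (hν' : 0 ∈ interior (integrableExpSet id ν'))
    (hmoments : ∀ k : ℕ, ∫ x, x ^ k ∂ν' = ∫ x, x ^ k ∂ν) :
    complexMGF id ν' =ᶠ[𝓝 0] complexMGF id ν := by
  have htaylor (n : ℕ) :
      iteratedDeriv n (complexMGF id ν') 0 = iteratedDeriv n (complexMGF id ν) 0 := by
    rw [iteratedDeriv_complexMGF (by simpa using hν'), iteratedDeriv_complexMGF (by simpa using hν)]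
    simp only [id_eq, zero_mul, Complex.exp_zero, mul_one, ← Complex.ofReal_pow,
      integral_complex_ofReal, hmoments]
  have hseries' := (analyticAt_complexMGF (z := 0) (by simpa using hν')).hasFPowerSeriesAt
  have hseries := (analyticAt_complexMGF (z := 0) (by simpa using hν)).hasFPowerSeriesAt
  simp only [htaylor] at hseries'
  filter_upwards [hseries'.eventually_hasSum_sub, hseries.eventually_hasSum_sub] with z h' h
  exact h'.unique h

theorem measure_eq_of_moments_eq {ν' : Measure ℝ} [IsFiniteMeasure ν] [IsFiniteMeasure ν']
    (hν : 0 ∈ interior (integrableExpSet id ν)) (hν' : 0 ∈ interior (integrableExpSet id ν'))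
    (hmoments : ∀ k : ℕ, ∫ x, x ^ k ∂ν' = ∫ x, x ^ k ∂ν) : ν' = ν := by
  have hstrip : Set.EqOn (complexMGF id ν') (complexMGF id ν) {z | z.re ∈
      interior (integrableExpSet id ν') ∩ interior (integrableExpSet id ν)} :=
    AnalyticOnNhd.eqOn_of_preconnected_of_eventuallyEq (z₀ := 0)
      (analyticOnNhd_complexMGF.mono fun z hz => hz.1)
      (analyticOnNhd_complexMGF.mono fun z hz => hz.2)
      ((convex_integrableExpSet.interior.inter convex_integrableExpSet.interior).linear_preimage
        Complex.reLm).isPreconnected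
      (by simpa using ⟨hν', hν⟩) (complexMGF_eventuallyEq_of_moments_eq hν hν' hmoments)
  refine Measure.ext_of_charFun (funext fun t => ?_)
  rw [← complexMGF_id_mul_I, ← complexMGF_id_mul_I]
  exact hstrip (by simpa using ⟨hν', hν⟩)

theorem isDeterminedByMoments_of_zero_mem_interior_integrableExpSet [IsFiniteMeasure ν]
    (hν : 0 ∈ interior (integrableExpSet id ν)) : IsDeterminedByMoments ν := by
  have hint (k : ℕ) : Integrable (fun x : ℝ => x ^ k) ν :=
    integrable_pow_of_mem_interior_integrableExpSet hν k
  refine ⟨hint, fun ν' _ hint' hmoments => ?_⟩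
  obtain ⟨ε, hε, hcosh⟩ := zero_mem_interior_integrableExpSet_iff.1 hν
  -- The even moments bound the integral of `cosh`, so `ν'` has exponential moments as well.
  have hcosh' : Integrable (fun x => Real.cosh (ε * x)) ν' := by
    rw [integrable_cosh_mul_iff, lintegral_cosh_eq_tsum_moments hint'] at *
    simpa only [hmoments, ← lintegral_cosh_eq_tsum_moments hint] using hcosh
  exact measure_eq_of_moments_eq hν (zero_mem_interior_integrableExpSet_iff.2 ⟨ε, hε, hcosh'⟩)
    hmoments

end Moments

section SubWeibull

variable {Ω : Type*} [MeasurableSpace Ω] {P : Measure Ω}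

/-- `X` has sub-Weibull tails with parameter `θ`: up to constants, `P (|X| > x ^ θ)` decays like
`exp (-x)`. Sub-Gaussian tails are the case `θ = 1 / 2`, subexponential tails the case `θ = 1`;
the smaller `θ`, the thinner the tails. -/
def IsSubWeibull (X : Ω → ℝ) (θ : ℝ) (P : Measure Ω) : Prop :=
  ∃ K C : ℝ, 0 ≤ K ∧ ∀ x ≥ 1, P.real {ω | K * x ^ θ < |X ω|} ≤ C * Real.exp (-x)

theorem measureReal_lt_limit_le [IsFiniteMeasure P] {X : ℕ → Ω → ℝ} {Y : Ω → ℝ}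
    (hlim : ∀ᵐ ω ∂P, Tendsto (fun n => X n ω) atTop (𝓝 (Y ω))) {y t : ℝ}
    (htail : ∀ᶠ n in atTop, P.real {ω | y < X n ω} ≤ t) : P.real {ω | y < Y ω} ≤ t := by
  let A : ℕ → Set Ω := fun j => {ω | ∀ n ≥ j, y < X n ω}
  have hA_mono : Monotone A := fun i j hij ω hω n hn => hω n (hij.trans hn)
  have hA (j : ℕ) : P.real (A j) ≤ t := by
    obtain ⟨n, hnt, hjn⟩ := (htail.and (eventually_ge_atTop j)).exists
    exact (measureReal_mono (Set.ofPred_subset_ofPred_of_imp fun ω hω => hω n hjn)).trans hnt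
  refine ENNReal.toReal_le_of_le_ofReal (measureReal_nonneg.trans (hA 0)) ?_
  calc P {ω | y < Y ω} ≤ P (⋃ j, A j) := by
        refine measure_mono_ae ?_
        filter_upwards [hlim] with ω hω hy
        exact Set.mem_iUnion.2 (eventually_atTop.1 (hω.eventually_const_lt hy))
    _ = ⨆ j, P (A j) := hA_mono.measure_iUnion
    _ ≤ _ := iSup_le fun j => ofReal_measureReal (μ := P) (s := A j) ▸
        ENNReal.ofReal_le_ofReal (hA j)

namespace IsSubWeibull

variable {X Y : Ω → ℝ} {θ θ₁ θ₂ : ℝ}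

theorem of_forall_nat [IsFiniteMeasure P] (hθ : 0 ≤ θ) {K C : ℝ} (hK : 0 ≤ K)
    (htail : ∀ N : ℕ, P.real {ω | K * ((N : ℝ) + 1) ^ θ < |X ω|} ≤ C * Real.exp (-((N : ℝ) + 1))) :
    IsSubWeibull X θ P := by
  have hC : 0 ≤ C := nonneg_of_mul_nonneg_left (measureReal_nonneg.trans (htail 0)) (Real.exp_pos _)
  refine ⟨K, C * Real.exp 1, hK, fun x hx => ?_⟩
  obtain ⟨N, hN⟩ : ∃ N, ⌊x⌋₊ = N + 1 :=
    Nat.exists_eq_succ_of_ne_zero (Nat.floor_pos.2 hx).ne'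
  have hNx : (N : ℝ) + 1 ≤ x := by exact_mod_cast hN ▸ Nat.floor_le (zero_le_one.trans hx)
  have hxN : x < (N : ℝ) + 1 + 1 := by exact_mod_cast hN ▸ Nat.lt_floor_add_one x
  calc P.real {ω | K * x ^ θ < |X ω|}
      ≤ P.real {ω | K * ((N : ℝ) + 1) ^ θ < |X ω|} :=
        measureReal_mono (Set.ofPred_subset_ofPred_of_imp fun ω =>
          lt_of_le_of_lt (by gcongr))
    _ ≤ C * Real.exp (-((N : ℝ) + 1)) := htail N
    _ ≤ C * Real.exp (1 + -x) := by gcongr; linarith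
    _ = C * Real.exp 1 * Real.exp (-x) := by rw [Real.exp_add, mul_assoc]

theorem of_tendsto [IsFiniteMeasure P] (hθ : 0 ≤ θ) {Z : ℕ → Ω → ℝ} {K C : ℝ} (hK : 0 ≤ K)
    (htail : ∀ N n : ℕ, N ≤ n →
      P.real {ω | K * ((N : ℝ) + 1) ^ θ < |Z n ω|} ≤ C * Real.exp (-((N : ℝ) + 1)))
    (hlim : ∀ᵐ ω ∂P, Tendsto (fun n => Z n ω) atTop (𝓝 (X ω))) : IsSubWeibull X θ P :=
  of_forall_nat hθ hK fun N => measureReal_lt_limit_le (X := fun n ω => |Z n ω|)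
    (hlim.mono fun _ hω => hω.abs) ((eventually_ge_atTop N).mono fun n hn => htail N n hn)

theorem mono [IsFiniteMeasure P] (hX : IsSubWeibull X θ₁ P) (hθ : θ₁ ≤ θ₂) :
    IsSubWeibull X θ₂ P := by
  obtain ⟨K, C, hK, htail⟩ := hX
  refine ⟨K, C, hK, fun x hx => le_trans (measureReal_mono ?_) (htail x hx)⟩
  exact Set.ofPred_subset_ofPred_of_imp fun ω =>
    lt_of_le_of_lt (mul_le_mul_of_nonneg_left (Real.rpow_le_rpow_of_exponent_le hx hθ) hK)

theorem const_mul [IsFiniteMeasure P] (hX : IsSubWeibull X θ P) (r : ℝ) :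
    IsSubWeibull (fun ω => r * X ω) θ P := by
  obtain ⟨K, C, hK, htail⟩ := hX
  refine ⟨|r| * K, C, by positivity, fun x hx => le_trans (measureReal_mono ?_) (htail x hx)⟩
  refine Set.ofPred_subset_ofPred_of_imp fun ω hω => ?_
  rw [abs_mul, mul_assoc] at hω
  exact lt_of_mul_lt_mul_left hω (abs_nonneg r)

theorem rpow [IsFiniteMeasure P] (hX : IsSubWeibull X θ P) {σ : ℝ} (hσ : 0 ≤ σ) :
    IsSubWeibull (fun ω => X ω ^ σ) (θ * σ) P := by
  obtain ⟨K, C, hK, htail⟩ := hX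
  refine ⟨K ^ σ, C, by positivity, fun x hx => le_trans (measureReal_mono ?_) (htail x hx)⟩
  refine Set.ofPred_subset_ofPred_of_imp fun ω => ?_
  have hx0 : 0 ≤ x := zero_le_one.trans hx
  contrapose!
  intro hle
  calc |X ω ^ σ| ≤ |X ω| ^ σ := Real.abs_rpow_le_abs_rpow _ _
    _ ≤ (K * x ^ θ) ^ σ := by gcongr
    _ = K ^ σ * x ^ (θ * σ) := by rw [Real.mul_rpow hK (by positivity), Real.rpow_mul hx0]

theorem mul [IsFiniteMeasure P] (hX : IsSubWeibull X θ₁ P) (hY : IsSubWeibull Y θ₂ P) :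
    IsSubWeibull (fun ω => X ω * Y ω) (θ₁ + θ₂) P := by
  obtain ⟨K₁, C₁, hK₁, htail₁⟩ := hX
  obtain ⟨K₂, C₂, hK₂, htail₂⟩ := hY
  refine ⟨K₁ * K₂, C₁ + C₂, by positivity, fun x hx => ?_⟩
  have hx0 : 0 < x := zero_lt_one.trans_le hx
  have hsub : {ω | K₁ * K₂ * x ^ (θ₁ + θ₂) < |X ω * Y ω|} ⊆
      {ω | K₁ * x ^ θ₁ < |X ω|} ∪ {ω | K₂ * x ^ θ₂ < |Y ω|} := by
    intro ω
    simp only [Set.mem_union, Set.mem_ofPred_eq]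
    contrapose!
    intro hnot
    calc |X ω * Y ω| = |X ω| * |Y ω| := abs_mul _ _
      _ ≤ (K₁ * x ^ θ₁) * (K₂ * x ^ θ₂) := by gcongr; exacts [hnot.1, hnot.2]
      _ = K₁ * K₂ * x ^ (θ₁ + θ₂) := by rw [Real.rpow_add hx0]; ring
  calc P.real {ω | K₁ * K₂ * x ^ (θ₁ + θ₂) < |X ω * Y ω|}
      ≤ P.real {ω | K₁ * x ^ θ₁ < |X ω|} + P.real {ω | K₂ * x ^ θ₂ < |Y ω|} :=
        (measureReal_mono hsub).trans (measureReal_union_le _ _)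
    _ ≤ C₁ * Real.exp (-x) + C₂ * Real.exp (-x) := add_le_add (htail₁ x hx) (htail₂ x hx)
    _ = (C₁ + C₂) * Real.exp (-x) := by ring

theorem exists_integrable_exp_mul_abs [IsFiniteMeasure P] (hXm : AEMeasurable X P)
    (hX : IsSubWeibull X 1 P) : ∃ ε > 0, Integrable (fun ω => Real.exp (ε * |X ω|)) P := by
  obtain ⟨K, C, hK, htail⟩ := hX
  have hε : 0 < 1 / (2 * (K + 1)) := by positivity
  refine ⟨1 / (2 * (K + 1)), hε, AEMeasurable.aestronglyMeasurable (by fun_prop), ?_⟩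
  have htail_exp (t : ℝ) (ht : Real.exp 1 < t) :
      P {ω | t < Real.exp (1 / (2 * (K + 1)) * |X ω|)} ≤ ENNReal.ofReal (C * t ^ (-2 : ℝ)) := by
    have ht0 : 0 < t := (Real.exp_pos 1).trans ht
    have hlog : 1 < Real.log t := (Real.lt_log_iff_exp_lt ht0).2 ht
    have hsub : {ω | t < Real.exp (1 / (2 * (K + 1)) * |X ω|)} ⊆
        {ω | K * (2 * Real.log t) ^ (1 : ℝ) < |X ω|} := by
      refine Set.ofPred_subset_ofPred_of_imp fun ω hω => ?_
      rw [← Real.log_lt_iff_lt_exp ht0, div_mul_eq_mul_div, one_mul,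
        lt_div_iff₀ (by positivity)] at hω
      rw [Real.rpow_one]
      linarith
    rw [← ofReal_measureReal]
    refine ENNReal.ofReal_le_ofReal ?_
    calc _ ≤ _ := measureReal_mono hsub
      _ ≤ C * Real.exp (-(2 * Real.log t)) := htail _ (by linarith)
      _ = C * t ^ (-2 : ℝ) := by rw [Real.rpow_def_of_pos ht0]; ring_nf
  rw [hasFiniteIntegral_iff_ofReal (ae_of_all _ fun _ => (Real.exp_pos _).le),
    lintegral_eq_lintegral_meas_lt P (ae_of_all _ fun _ => (Real.exp_pos _).le) (by fun_prop),
    ← Set.Ioc_union_Ioi_eq_Ioi (Real.exp_pos 1).le]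
  refine (lintegral_union_le _ _ _).trans_lt (ENNReal.add_lt_top.2 ⟨?_, ?_⟩)
  · refine setLIntegral_lt_top_of_le_nnreal (by simp) ⟨(P Set.univ).toNNReal, fun t _ => ?_⟩
    rw [ENNReal.coe_toNNReal (measure_ne_top P _)]
    exact measure_mono (Set.subset_univ _)
  · exact (setLIntegral_mono' measurableSet_Ioi htail_exp).trans_lt
      ((integrableOn_Ioi_rpow_of_lt (by norm_num) (Real.exp_pos 1)).const_mul C).lintegral_lt_top

theorem isDeterminedByMoments_map [IsFiniteMeasure P] (hXm : AEMeasurable X P)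
    (hX : IsSubWeibull X 1 P) : IsDeterminedByMoments (P.map X) := by
  obtain ⟨ε, hε, hint⟩ := hX.exists_integrable_exp_mul_abs hXm
  refine isDeterminedByMoments_of_zero_mem_interior_integrableExpSet
    (zero_mem_interior_integrableExpSet_iff.2 ⟨ε, hε, ?_⟩)
  rw [integrable_map_measure (by fun_prop) hXm]
  refine hint.mono' (AEMeasurable.aestronglyMeasurable (by fun_prop)) (ae_of_all _ fun ω => ?_)
  rw [Function.comp_apply, Real.norm_eq_abs, abs_of_pos (Real.cosh_pos _), ← Real.cosh_abs,
    abs_mul, abs_of_pos hε, Real.cosh_eq]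
  have : Real.exp (-(ε * |X ω|)) ≤ Real.exp (ε * |X ω|) :=
    Real.exp_le_exp.2 (neg_le_self (by positivity))
  linarith

end IsSubWeibull
end SubWeibull

section Martingale

theorem exp_le_add_exp_sq (x : ℝ) : Real.exp x ≤ x + Real.exp (x ^ 2) := by
  have hsq : x ^ 2 + 1 ≤ Real.exp (x ^ 2) := Real.add_one_le_exp _
  rcases le_or_gt |x| 1 with hx | hx
  · linarith [le_of_abs_le (Real.abs_exp_sub_one_sub_id_le hx)]
  rcases lt_abs.1 hx with hx | hx
  · have : Real.exp x ≤ Real.exp (x ^ 2) := Real.exp_le_exp.2 (by nlinarith)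
    linarith
  · have : Real.exp x ≤ 1 := Real.exp_le_one_iff.2 (by linarith)
    nlinarith

theorem sum_Ico_rpow_neg_le {p : ℝ} (hp : 1 < p) {N n : ℕ} (hNn : N ≤ n) :
    ∑ k ∈ Finset.Ico N n, ((k : ℝ) + 1) ^ (-p) ≤ 2 ^ p / (p - 1) * ((N : ℝ) + 1) ^ (1 - p) := by
  have hanti : AntitoneOn (fun x : ℝ => (x + 1) ^ (-p)) (Set.Icc (N : ℝ) n) :=
    fun x hx y _ hxy => Real.rpow_le_rpow_of_nonpos
      (by linarith [hx.1, N.cast_nonneg (α := ℝ)]) (by linarith) (by linarith)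
  have hshift (k : ℕ) : ((k : ℝ) + 1) ^ (-p) ≤ 2 ^ p * (((k + 1 : ℕ) : ℝ) + 1) ^ (-p) := by
    have hk : ((k + 1 : ℕ) : ℝ) + 1 ≤ 2 * ((k : ℝ) + 1) := by
      push_cast
      linarith [k.cast_nonneg (α := ℝ)]
    calc ((k : ℝ) + 1) ^ (-p) = 2 ^ p * (2 * ((k : ℝ) + 1)) ^ (-p) := by
          rw [Real.mul_rpow zero_le_two (by positivity), ← mul_assoc,
            ← Real.rpow_add zero_lt_two, add_neg_cancel, Real.rpow_zero, one_mul]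
      _ ≤ _ := mul_le_mul_of_nonneg_left
          (Real.rpow_le_rpow_of_nonpos (by positivity) hk (by linarith)) (by positivity)
  have hintegral : ∫ x in (N : ℝ)..n, (x + 1) ^ (-p) =
      (((N : ℝ) + 1) ^ (1 - p) - ((n : ℝ) + 1) ^ (1 - p)) / (p - 1) := by
    have hzero : (0 : ℝ) ∉ Set.uIcc ((N : ℝ) + 1) ((n : ℝ) + 1) := by
      rw [Set.uIcc_of_le (by gcongr)]
      exact fun h => h.1.not_gt (by positivity)
    rw [intervalIntegral.integral_comp_add_right (fun x : ℝ => x ^ (-p)),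
      integral_rpow (Or.inr ⟨by linarith, hzero⟩), neg_add_eq_sub, ← neg_div_neg_eq, neg_sub,
      neg_sub]
  calc ∑ k ∈ Finset.Ico N n, ((k : ℝ) + 1) ^ (-p)
      ≤ 2 ^ p * ∑ k ∈ Finset.Ico N n, (((k + 1 : ℕ) : ℝ) + 1) ^ (-p) := by
        rw [Finset.mul_sum]
        exact Finset.sum_le_sum fun k _ => hshift k
    _ ≤ 2 ^ p * ((((N : ℝ) + 1) ^ (1 - p) - ((n : ℝ) + 1) ^ (1 - p)) / (p - 1)) := by
        rw [← hintegral]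
        gcongr
        exact hanti.sum_le_integral_Ico hNn
    _ ≤ 2 ^ p * (((N : ℝ) + 1) ^ (1 - p) / (p - 1)) := by
        have : 0 ≤ ((n : ℝ) + 1) ^ (1 - p) := by positivity
        gcongr
        linarith
    _ = _ := by ring

variable {Ω : Type*} [mΩ : MeasurableSpace Ω] {P : Measure Ω} {ℱ : Filtration ℕ mΩ}
  {M : ℕ → Ω → ℝ}

theorem integral_mul_martingale_sub_eq_zero [SigmaFiniteFiltration P ℱ] (hM : Martingale M ℱ P)
    (n : ℕ) {Y : Ω → ℝ} (hY : StronglyMeasurable[ℱ n] Y)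
    (hint : Integrable (Y * (M (n + 1) - M n)) P) : ∫ ω, Y ω * (M (n + 1) ω - M n ω) ∂P = 0 := by
  have hincr : P[M (n + 1) - M n | ℱ n] =ᵐ[P] 0 := by
    filter_upwards [condExp_sub (hM.integrable (n + 1)) (hM.integrable n) (ℱ n),
      hM.condExp_ae_eq n.le_succ, hM.condExp_ae_eq (le_refl n)] with ω hsub hsucc hself
    rw [hsub, Pi.sub_apply, hsucc, hself, sub_self, Pi.zero_apply]
  have hpull := condExp_mul_of_stronglyMeasurable_left hY hint
    ((hM.integrable (n + 1)).sub (hM.integrable n))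
  calc ∫ ω, Y ω * (M (n + 1) ω - M n ω) ∂P
      = ∫ ω, (P[Y * (M (n + 1) - M n) | ℱ n]) ω ∂P := (integral_condExp (ℱ.le n)).symm
    _ = ∫ _, (0 : ℝ) ∂P := by
        refine integral_congr_ae ?_
        filter_upwards [hpull, hincr] with ω hω hzero
        rw [hω, Pi.mul_apply, hzero, Pi.zero_apply, mul_zero]
    _ = 0 := integral_zero _ _

theorem mgf_martingale_succ_le [IsFiniteMeasure P] (hM : Martingale M ℱ P) (n : ℕ) {c l : ℝ}
    (hincr : ∀ᵐ ω ∂P, |M (n + 1) ω - M n ω| ≤ c)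
    (hint : ∀ k, Integrable (fun ω => Real.exp (l * M k ω)) P) :
    mgf (M (n + 1)) P l ≤ Real.exp ((l * c) ^ 2) * mgf (M n) P l := by
  have hmeas (k : ℕ) : StronglyMeasurable[ℱ k] (M k) := hM.stronglyAdapted k
  have hY : StronglyMeasurable[ℱ n] fun ω => l * Real.exp (l * M n ω) :=
    ((Real.continuous_exp.comp_stronglyMeasurable ((hmeas n).const_mul l)).const_mul l)
  have hYint : Integrable ((fun ω => l * Real.exp (l * M n ω)) * (M (n + 1) - M n)) P :=
    ((hint n).const_mul l).mul_bdd
      (((hM.integrable (n + 1)).sub (hM.integrable n)).aestronglyMeasurable) hincr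
  have hzero := integral_mul_martingale_sub_eq_zero hM n hY hYint
  calc mgf (M (n + 1)) P l
      ≤ ∫ ω, (l * Real.exp (l * M n ω) * (M (n + 1) ω - M n ω) +
          Real.exp ((l * c) ^ 2) * Real.exp (l * M n ω)) ∂P := by
        refine integral_mono_ae (hint (n + 1)) (hYint.add ((hint n).const_mul _)) ?_
        filter_upwards [hincr] with ω hω
        have hsq : (l * (M (n + 1) ω - M n ω)) ^ 2 ≤ (l * c) ^ 2 := by
          rw [mul_pow, mul_pow]
          exact mul_le_mul_of_nonneg_left (sq_le_sq' (abs_le.1 hω).1 (abs_le.1 hω).2) (sq_nonneg l)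
        calc Real.exp (l * M (n + 1) ω)
            = Real.exp (l * M n ω) * Real.exp (l * (M (n + 1) ω - M n ω)) := by
              rw [← Real.exp_add]
              ring_nf
          _ ≤ Real.exp (l * M n ω) *
                (l * (M (n + 1) ω - M n ω) + Real.exp ((l * c) ^ 2)) := by
              gcongr
              exact (exp_le_add_exp_sq _).trans (by gcongr)
          _ = _ := by ring
    _ = Real.exp ((l * c) ^ 2) * mgf (M n) P l := by
        refine (integral_add hYint ((hint n).const_mul _)).trans ?_
        rw [integral_const_mul, mgf]
        exact (congrArg (· + _) hzero).trans (zero_add _)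

theorem mgf_martingale_le [IsFiniteMeasure P] (hM : Martingale M ℱ P) {c : ℕ → ℝ} {l : ℝ}
    (hincr : ∀ n, ∀ᵐ ω ∂P, |M (n + 1) ω - M n ω| ≤ c n)
    (hint : ∀ n, Integrable (fun ω => Real.exp (l * M n ω)) P) {N n : ℕ} (hNn : N ≤ n) :
    mgf (M n) P l ≤ Real.exp (∑ k ∈ Finset.Ico N n, (l * c k) ^ 2) * mgf (M N) P l := by
  induction n, hNn using Nat.le_induction with
  | base => simp
  | succ n hNn ih =>
    calc mgf (M (n + 1)) P l ≤ Real.exp ((l * c n) ^ 2) * mgf (M n) P l :=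
          mgf_martingale_succ_le hM n (hincr n) hint
      _ ≤ Real.exp ((l * c n) ^ 2) *
            (Real.exp (∑ k ∈ Finset.Ico N n, (l * c k) ^ 2) * mgf (M N) P l) := by gcongr
      _ = _ := by rw [Finset.sum_Ico_succ_top hNn, add_comm, Real.exp_add, mul_assoc]

section PolynomialIncrements

variable [IsProbabilityMeasure P] {σ B C : ℝ}

theorem integrable_exp_mul_martingale (hM : Martingale M ℱ P)
    (hsize : ∀ n, ∀ᵐ ω ∂P, |M n ω| ≤ B * ((n : ℝ) + 1) ^ (1 - σ)) (l : ℝ) (n : ℕ) :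
    Integrable (fun ω => Real.exp (l * M n ω)) P :=
  integrable_exp_mul_of_mem_Icc (hM.integrable n).aemeasurable
    ((hsize n).mono fun _ hω => abs_le.1 hω)

theorem mgf_martingale_le_exp (hM : Martingale M ℱ P) (hσ : 1 / 2 < σ)
    (hsize : ∀ n, ∀ᵐ ω ∂P, |M n ω| ≤ B * ((n : ℝ) + 1) ^ (1 - σ))
    (hincr : ∀ n, ∀ᵐ ω ∂P, |M (n + 1) ω - M n ω| ≤ C * ((n : ℝ) + 1) ^ (-σ))
    {N n : ℕ} (hNn : N ≤ n) {l : ℝ} (hl : |l| = ((N : ℝ) + 1) ^ σ) :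
    mgf (M n) P l ≤
      Real.exp ((C ^ 2 * (2 ^ (2 * σ) / (2 * σ - 1)) + B) * ((N : ℝ) + 1)) := by
  have hN : (0 : ℝ) < (N : ℝ) + 1 := by positivity
  have hsq (k : ℕ) : (l * (C * ((k : ℝ) + 1) ^ (-σ))) ^ 2 =
      ((N : ℝ) + 1) ^ (2 * σ) * C ^ 2 * ((k : ℝ) + 1) ^ (-(2 * σ)) := by
    have hpow {x r : ℝ} (hx : 0 ≤ x) : (x ^ r) ^ 2 = x ^ (2 * r) := by
      rw [← Real.rpow_mul_natCast hx, mul_comm, Nat.cast_ofNat]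
    rw [mul_pow, mul_pow, ← sq_abs l, hl, hpow hN.le, hpow (by positivity), mul_neg, mul_assoc]
  have hsum : ∑ k ∈ Finset.Ico N n, (l * (C * ((k : ℝ) + 1) ^ (-σ))) ^ 2 ≤
      C ^ 2 * (2 ^ (2 * σ) / (2 * σ - 1)) * ((N : ℝ) + 1) := by
    simp_rw [hsq]
    rw [← Finset.mul_sum]
    calc _ ≤ ((N : ℝ) + 1) ^ (2 * σ) * C ^ 2 *
          (2 ^ (2 * σ) / (2 * σ - 1) * ((N : ℝ) + 1) ^ (1 - 2 * σ)) := by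
          gcongr
          exact sum_Ico_rpow_neg_le (by linarith) hNn
      _ = C ^ 2 * (2 ^ (2 * σ) / (2 * σ - 1)) *
          (((N : ℝ) + 1) ^ (2 * σ) * ((N : ℝ) + 1) ^ (1 - 2 * σ)) := by ring
      _ = _ := by rw [← Real.rpow_add hN, add_sub_cancel, Real.rpow_one]
  have hstart : mgf (M N) P l ≤ Real.exp (B * ((N : ℝ) + 1)) := by
    have hbound : ∀ᵐ ω ∂P, l * M N ω ≤ B * ((N : ℝ) + 1) := by
      filter_upwards [hsize N] with ω hω
      calc l * M N ω ≤ |l| * |M N ω| := (le_abs_self _).trans_eq (abs_mul _ _)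
        _ ≤ ((N : ℝ) + 1) ^ σ * (B * ((N : ℝ) + 1) ^ (1 - σ)) := by rw [hl]; gcongr
        _ = B * (((N : ℝ) + 1) ^ σ * ((N : ℝ) + 1) ^ (1 - σ)) := by ring
        _ = _ := by rw [← Real.rpow_add hN, add_sub_cancel, Real.rpow_one]
    simpa [mgf] using integral_mono_of_nonneg (ae_of_all _ fun _ => (Real.exp_pos _).le)
      (integrable_const (Real.exp (B * ((N : ℝ) + 1))))
      (hbound.mono fun _ hω => Real.exp_le_exp.2 hω)
  rw [add_mul, Real.exp_add]
  exact (mgf_martingale_le hM hincr (integrable_exp_mul_martingale hM hsize l) hNn).trans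
    (mul_le_mul (Real.exp_le_exp.2 hsum) hstart mgf_nonneg (Real.exp_pos _).le)

theorem measureReal_lt_abs_martingale_le (hM : Martingale M ℱ P) (hσ : 1 / 2 < σ)
    (hsize : ∀ n, ∀ᵐ ω ∂P, |M n ω| ≤ B * ((n : ℝ) + 1) ^ (1 - σ))
    (hincr : ∀ n, ∀ᵐ ω ∂P, |M (n + 1) ω - M n ω| ≤ C * ((n : ℝ) + 1) ^ (-σ))
    {N n : ℕ} (hNn : N ≤ n) :
    P.real {ω | (C ^ 2 * (2 ^ (2 * σ) / (2 * σ - 1)) + B + 1) * ((N : ℝ) + 1) ^ (1 - σ) <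
      |M n ω|} ≤ 2 * Real.exp (-((N : ℝ) + 1)) := by
  have hN : (0 : ℝ) < (N : ℝ) + 1 := by positivity
  set D := C ^ 2 * (2 ^ (2 * σ) / (2 * σ - 1)) + B
  set y := (D + 1) * ((N : ℝ) + 1) ^ (1 - σ)
  have hexponent : ((N : ℝ) + 1) ^ σ * y = (D + 1) * ((N : ℝ) + 1) := by
    rw [mul_left_comm, ← Real.rpow_add hN, add_sub_cancel, Real.rpow_one]
  have hchernoff (l : ℝ) (hl : |l| = ((N : ℝ) + 1) ^ σ) :
      Real.exp (-(((N : ℝ) + 1) ^ σ * y)) * mgf (M n) P l ≤ Real.exp (-((N : ℝ) + 1)) := by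
    calc _ ≤ Real.exp (-(((N : ℝ) + 1) ^ σ * y)) * Real.exp (D * ((N : ℝ) + 1)) := by
          gcongr
          exact mgf_martingale_le_exp hM hσ hsize hincr hNn hl
      _ = _ := by rw [hexponent, ← Real.exp_add]; ring_nf
  have hl : (0 : ℝ) ≤ ((N : ℝ) + 1) ^ σ := by positivity
  have hupper : P.real {ω | y ≤ M n ω} ≤ Real.exp (-((N : ℝ) + 1)) := by
    refine (measure_ge_le_exp_mul_mgf y hl
      (integrable_exp_mul_martingale hM hsize _ n)).trans ?_
    rw [neg_mul]
    exact hchernoff _ (abs_of_nonneg hl)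
  have hlower : P.real {ω | M n ω ≤ -y} ≤ Real.exp (-((N : ℝ) + 1)) := by
    refine (measure_le_le_exp_mul_mgf (-y) (neg_nonpos.2 hl)
      (integrable_exp_mul_martingale hM hsize _ n)).trans ?_
    rw [neg_neg, mul_neg]
    exact hchernoff _ ((abs_neg _).trans (abs_of_nonneg hl))
  calc P.real {ω | y < |M n ω|} ≤ P.real ({ω | y ≤ M n ω} ∪ {ω | M n ω ≤ -y}) :=
        measureReal_mono (Set.ofPred_subset_ofPred_of_imp fun ω hω =>
          (lt_abs.1 hω).imp le_of_lt fun h => (lt_neg.1 h).le)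
    _ ≤ Real.exp (-((N : ℝ) + 1)) + Real.exp (-((N : ℝ) + 1)) :=
        (measureReal_union_le _ _).trans (add_le_add hupper hlower)
    _ = _ := (two_mul _).symm

theorem exists_eLpNorm_martingale_le (hM : Martingale M ℱ P) (hσ : 1 / 2 < σ)
    (hsize : ∀ n, ∀ᵐ ω ∂P, |M n ω| ≤ B * ((n : ℝ) + 1) ^ (1 - σ))
    (hincr : ∀ n, ∀ᵐ ω ∂P, |M (n + 1) ω - M n ω| ≤ C * ((n : ℝ) + 1) ^ (-σ)) :
    ∃ R : ℝ≥0, ∀ n, eLpNorm (M n) 1 P ≤ R := by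
  refine ⟨(2 * Real.exp (C ^ 2 * (2 ^ (2 * σ) / (2 * σ - 1)) + B)).toNNReal, fun n => ?_⟩
  have hmgf (l : ℝ) (hl : |l| = 1) :
      mgf (M n) P l ≤ Real.exp (C ^ 2 * (2 ^ (2 * σ) / (2 * σ - 1)) + B) := by
    simpa using mgf_martingale_le_exp hM hσ hsize hincr n.zero_le (by simpa using hl)
  have hexp := integrable_exp_mul_martingale hM hsize
  rw [eLpNorm_one_eq_lintegral_enorm, ← ofReal_integral_norm_eq_lintegral_enorm (hM.integrable n)]
  refine ENNReal.ofReal_le_ofReal ?_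
  calc ∫ ω, ‖M n ω‖ ∂P ≤ ∫ ω, (Real.exp (1 * M n ω) + Real.exp (-1 * M n ω)) ∂P := by
        refine integral_mono (hM.integrable n).norm ((hexp 1 n).add (hexp (-1) n)) fun ω => ?_
        rw [one_mul, neg_one_mul]
        refine abs_le'.2 ⟨?_, ?_⟩
        · linarith [Real.add_one_le_exp (M n ω), Real.exp_pos (-M n ω)]
        · linarith [Real.add_one_le_exp (-M n ω), Real.exp_pos (M n ω)]
    _ = mgf (M n) P 1 + mgf (M n) P (-1) := integral_add (hexp 1 n) (hexp (-1) n)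
    _ ≤ _ := (add_le_add (hmgf 1 abs_one) (hmgf (-1) (by simp))).trans_eq (two_mul _).symm

theorem exists_tendsto_isSubWeibull_of_martingale (hM : Martingale M ℱ P) (hσ : 1 / 2 < σ)
    (hσ_le : σ ≤ 1) (hsize : ∀ n, ∀ᵐ ω ∂P, |M n ω| ≤ B * ((n : ℝ) + 1) ^ (1 - σ))
    (hincr : ∀ n, ∀ᵐ ω ∂P, |M (n + 1) ω - M n ω| ≤ C * ((n : ℝ) + 1) ^ (-σ)) :
    ∃ L : Ω → ℝ, Measurable L ∧ (∀ᵐ ω ∂P, Tendsto (fun n => M n ω) atTop (𝓝 (L ω))) ∧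
      IsSubWeibull L (1 - σ) P := by
  obtain ⟨R, hR⟩ := exists_eLpNorm_martingale_le hM hσ hsize hincr
  have hlim := hM.submartingale.ae_tendsto_limitProcess hR
  have hB : 0 ≤ B := by
    obtain ⟨ω, hω⟩ := (hsize 0).exists
    simpa using (abs_nonneg _).trans hω
  have : 0 ≤ 2 * σ - 1 := by linarith
  exact ⟨_, Filtration.stronglyMeasurable_limit_process'.measurable, hlim,
    .of_tendsto (sub_nonneg.2 hσ_le) (by positivity)
      (fun _ _ hNn => measureReal_lt_abs_martingale_le hM hσ hsize hincr hNn) hlim⟩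

end PolynomialIncrements
end Martingale

section Growth

/-- The growth product `∏ k < n, (1 + σ / (s + k))`, which behaves like `Γ(s) / Γ(s + σ) * n ^ σ`.
With `s = (α + β) / S` and `σ = m / S` it is the factor by which the mean of `u₂` grows during the
first `n` draws. -/
noncomputable def growth (s σ : ℝ) (n : ℕ) : ℝ := ∏ k ∈ Finset.range n, (1 + σ / (s + k))

variable {s σ : ℝ}

theorem growth_succ (s σ : ℝ) (n : ℕ) :
    growth s σ (n + 1) = growth s σ n * (1 + σ / (s + n)) :=
  Finset.prod_range_succ _ n

theorem growth_pos (hs : 0 < s) (hσ : 0 ≤ σ) (n : ℕ) : 0 < growth s σ n :=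
  Finset.prod_pos fun k _ => by positivity

theorem growth_le_growth_succ (hs : 0 < s) (hσ : 0 ≤ σ) (n : ℕ) :
    growth s σ n ≤ growth s σ (n + 1) := by
  rw [growth_succ]
  have : 0 ≤ σ / (s + n) := by positivity
  exact le_mul_of_one_le_right (growth_pos hs hσ n).le (by linarith)

theorem growth_succ_eq_gammaSeq (hs : 0 < s) (hσ : 0 ≤ σ) {n : ℕ} (hn : n ≠ 0) :
    growth s σ (n + 1) = (n : ℝ) ^ σ * (Real.GammaSeq s n / Real.GammaSeq (s + σ) n) := by
  have hgrowth : growth s σ (n + 1) =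
      (∏ j ∈ Finset.range (n + 1), (s + σ + j)) / ∏ j ∈ Finset.range (n + 1), (s + j) := by
    rw [growth, ← Finset.prod_div_distrib]
    refine Finset.prod_congr rfl fun k _ => ?_
    rw [add_right_comm, add_div, div_self (by positivity)]
  have : 0 < ∏ j ∈ Finset.range (n + 1), (s + j) := Finset.prod_pos fun k _ => by positivity
  have : 0 < ∏ j ∈ Finset.range (n + 1), (s + σ + j) := Finset.prod_pos fun k _ => by positivity
  have : 0 < n.factorial := n.factorial_pos
  have hn' : (0 : ℝ) < n := by positivity
  rw [hgrowth, Real.GammaSeq, Real.GammaSeq, Real.rpow_add hn']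
  field_simp

theorem tendsto_growth_div_rpow (hs : 0 < s) (hσ : 0 ≤ σ) :
    Tendsto (fun n : ℕ => growth s σ n / (n : ℝ) ^ σ) atTop
      (𝓝 (Real.Gamma s / Real.Gamma (s + σ))) := by
  rw [← tendsto_add_atTop_iff_nat 1]
  have hgamma : Tendsto (fun n : ℕ => Real.GammaSeq s n / Real.GammaSeq (s + σ) n) atTop
      (𝓝 (Real.Gamma s / Real.Gamma (s + σ))) :=
    (Real.GammaSeq_tendsto_Gamma s).div (Real.GammaSeq_tendsto_Gamma (s + σ))
      (Real.Gamma_pos_of_pos (by positivity)).ne'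
  have hshift : Tendsto (fun n : ℕ => ((n : ℝ) / (n + 1)) ^ σ) atTop (𝓝 1) := by
    simpa using (tendsto_natCast_div_add_atTop (1 : ℝ)).rpow_const (p := σ) (Or.inr hσ)
  have hmul := hshift.mul hgamma
  rw [one_mul] at hmul
  refine hmul.congr' ?_
  filter_upwards [eventually_ne_atTop 0] with n hn
  rw [growth_succ_eq_gammaSeq hs hσ hn, Real.div_rpow (by positivity) (by positivity)]
  push_cast
  ring

theorem tendsto_rpow_div_growth (hs : 0 < s) (hσ : 0 ≤ σ) :
    Tendsto (fun n : ℕ => (n : ℝ) ^ σ / growth s σ n) atTop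
      (𝓝 (Real.Gamma (s + σ) / Real.Gamma s)) := by
  have hpos : 0 < Real.Gamma s / Real.Gamma (s + σ) :=
    div_pos (Real.Gamma_pos_of_pos hs) (Real.Gamma_pos_of_pos (by positivity))
  simpa only [inv_div] using (tendsto_growth_div_rpow hs hσ).inv₀ hpos.ne'

theorem exists_add_one_rpow_le_mul_growth (hs : 0 < s) (hσ : 0 ≤ σ) :
    ∃ κ ≥ 0, ∀ n : ℕ, ((n : ℝ) + 1) ^ σ ≤ κ * growth s σ n := by
  obtain ⟨κ, hκ⟩ := (tendsto_rpow_div_growth hs hσ).bddAbove_range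
  have hle (n : ℕ) : (n : ℝ) ^ σ ≤ κ * growth s σ n :=
    (div_le_iff₀ (growth_pos hs hσ n)).1 (hκ (Set.mem_range_self n))
  have hκ_nonneg : 0 ≤ κ :=
    nonneg_of_mul_nonneg_left ((by positivity : (0 : ℝ) ≤ _).trans (hle 0)) (growth_pos hs hσ 0)
  refine ⟨κ * (1 + σ / s), by positivity, fun n => ?_⟩
  calc ((n : ℝ) + 1) ^ σ ≤ κ * (growth s σ n * (1 + σ / (s + n))) := by
        exact_mod_cast growth_succ s σ n ▸ hle (n + 1)
    _ ≤ κ * (growth s σ n * (1 + σ / s)) := by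
        have := growth_pos hs hσ n
        gcongr
        linarith [n.cast_nonneg (α := ℝ)]
    _ = _ := by ring

end Growth

section Composition

variable {a b c d : ℕ}

theorem add_pos_of_ratio_pos (hσ : 0 < ratio a b c) : 0 < (a : ℝ) + b := by
  refine lt_of_le_of_ne (by positivity) fun h => hσ.ne ?_
  rw [ratio, ← h, div_zero]

theorem ratio_le_one : ratio a b c ≤ 1 :=
  div_le_one_of_le₀ (by linarith [b.cast_nonneg (α := ℝ), c.cast_nonneg (α := ℝ)]) (by positivity)

theorem ratio_mul_add (hS : 0 < (a : ℝ) + b) : ratio a b c * ((a : ℝ) + b) = (a : ℝ) - c :=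
  div_mul_cancel₀ _ hS.ne'

theorem abs_u₂_le (v : ℕ × ℕ) :
    |u₂ a b c v| ≤ (b + c) / ((a : ℝ) + b) * ((v.1 : ℝ) + v.2) := by
  have hS : (0 : ℝ) ≤ (a : ℝ) + b := by positivity
  rw [u₂, abs_div, abs_of_nonneg hS, div_mul_eq_mul_div]
  gcongr
  calc |(b : ℝ) * v.1 - c * v.2| ≤ |(b : ℝ) * v.1| + |(c : ℝ) * v.2| := abs_sub _ _
    _ = (b : ℝ) * v.1 + c * v.2 := by rw [abs_of_nonneg, abs_of_nonneg] <;> positivity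
    _ ≤ ((b : ℝ) * v.1 + c * v.2) + (b * v.2 + c * v.1) := le_add_of_nonneg_right (by positivity)
    _ = _ := by ring

theorem u₂_add_red (hS : 0 < (a : ℝ) + b) {v : ℕ × ℕ} (hv : 0 < (v.1 : ℝ) + v.2) :
    u₂ a b c (v + (a, b)) = u₂ a b c v * (1 + ((a : ℝ) - c) / ((v.1 : ℝ) + v.2)) +
      ratio a b c * (b + c) * ((v.2 : ℝ) / ((v.1 : ℝ) + v.2)) := by
  simp only [u₂, ratio, Prod.fst_add, Prod.snd_add, Nat.cast_add]
  field_simp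
  ring

theorem u₂_add_black (hbalance : a + b = c + d) (hS : 0 < (a : ℝ) + b) {v : ℕ × ℕ}
    (hv : 0 < (v.1 : ℝ) + v.2) :
    u₂ a b c (v + (c, d)) = u₂ a b c v * (1 + ((a : ℝ) - c) / ((v.1 : ℝ) + v.2)) -
      ratio a b c * (b + c) * ((v.1 : ℝ) / ((v.1 : ℝ) + v.2)) := by
  have hd : (d : ℝ) = a + b - c := eq_sub_of_add_eq' (by exact_mod_cast hbalance.symm)
  simp only [u₂, ratio, Prod.fst_add, Prod.snd_add, Nat.cast_add, hd]
  field_simp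
  ring

theorem abs_u₂_draw_sub_le (hbalance : a + b = c + d) (hσ : 0 < ratio a b c) {v w : ℕ × ℕ}
    (hv : 0 < (v.1 : ℝ) + v.2) (hw : w = v + (a, b) ∨ w = v + (c, d)) :
    |u₂ a b c w - u₂ a b c v * (1 + ((a : ℝ) - c) / ((v.1 : ℝ) + v.2))| ≤
      ratio a b c * (b + c) := by
  have hS := add_pos_of_ratio_pos hσ
  have hfraction {x y : ℝ} (hx : 0 ≤ x) (hxy : x ≤ y) :
      |ratio a b c * (b + c) * (x / y)| ≤ ratio a b c * (b + c) := by
    rw [abs_of_nonneg (by have := hx.trans hxy; positivity)]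
    exact mul_le_of_le_one_right (by positivity) (div_le_one_of_le₀ hxy (hx.trans hxy))
  rcases hw with rfl | rfl
  · rw [u₂_add_red hS hv, add_sub_cancel_left]
    exact hfraction (by positivity) (le_add_of_nonneg_left (by positivity))
  · rw [u₂_add_black hbalance hS hv, sub_sub_cancel_left, abs_neg]
    exact hfraction (by positivity) (le_add_of_nonneg_right (by positivity))

/-- The law of the composition after one draw from an urn with composition `v`. It has total mass
`1` unless `v = (0, 0)`, where division by zero makes it vanish. -/
noncomputable def drawLaw (a b c d : ℕ) (v : ℕ × ℕ) : Measure (ℕ × ℕ) :=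
  ENNReal.ofReal ((v.1 : ℝ) / ((v.1 : ℝ) + v.2)) • Measure.dirac (v + (a, b)) +
    ENNReal.ofReal ((v.2 : ℝ) / ((v.1 : ℝ) + v.2)) • Measure.dirac (v + (c, d))

theorem drawLaw_singleton (v w : ℕ × ℕ) :
    drawLaw a b c d v {w} = ENNReal.ofReal (stepProb a b c d v w) := by
  have hdirac (p : ℝ) (x : ℕ × ℕ) :
      (ENNReal.ofReal p • Measure.dirac x) {w} = ENNReal.ofReal (p * if w = x then 1 else 0) := by
    by_cases hx : w = x <;> simp [hx, eq_comm]
  rw [drawLaw, Measure.add_apply, hdirac, hdirac, stepProb,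
    ENNReal.ofReal_add (by positivity) (by positivity)]

theorem ae_drawLaw (v : ℕ × ℕ) :
    ∀ᵐ w ∂(drawLaw a b c d v), w = v + (a, b) ∨ w = v + (c, d) := by
  rw [drawLaw, ae_add_measure_iff]
  exact ⟨Measure.ae_smul_measure (by simp [ae_dirac_eq]) _,
    Measure.ae_smul_measure (by simp [ae_dirac_eq]) _⟩

theorem integral_drawLaw (g : ℕ × ℕ → ℝ) (v : ℕ × ℕ) :
    ∫ w, g w ∂(drawLaw a b c d v) = (v.1 : ℝ) / ((v.1 : ℝ) + v.2) * g (v + (a, b)) +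
      (v.2 : ℝ) / ((v.1 : ℝ) + v.2) * g (v + (c, d)) := by
  rw [drawLaw, integral_add_measure
    ((integrable_dirac enorm_lt_top).smul_measure ENNReal.ofReal_ne_top)
    ((integrable_dirac enorm_lt_top).smul_measure ENNReal.ofReal_ne_top),
    integral_smul_measure, integral_smul_measure, integral_dirac, integral_dirac,
    ENNReal.toReal_ofReal (by positivity), ENNReal.toReal_ofReal (by positivity), smul_eq_mul,
    smul_eq_mul]

theorem integral_u₂_drawLaw (hbalance : a + b = c + d) (hS : 0 < (a : ℝ) + b) {v : ℕ × ℕ}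
    (hv : 0 < (v.1 : ℝ) + v.2) :
    ∫ w, u₂ a b c w ∂(drawLaw a b c d v) =
      u₂ a b c v * (1 + ((a : ℝ) - c) / ((v.1 : ℝ) + v.2)) := by
  have hone : (v.1 : ℝ) / ((v.1 : ℝ) + v.2) + (v.2 : ℝ) / ((v.1 : ℝ) + v.2) = 1 := by
    rw [← add_div, div_self hv.ne']
  rw [integral_drawLaw, u₂_add_red hS hv, u₂_add_black hbalance hS hv]
  linear_combination u₂ a b c v * (1 + ((a : ℝ) - c) / ((v.1 : ℝ) + v.2)) * hone

/-- The number of balls in the urn after `n` draws. -/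
abbrev total (a b α β n : ℕ) : ℕ := α + β + n * (a + b)

variable {α β : ℕ}

theorem total_pos (hαβ : (α, β) ≠ (0, 0)) (n : ℕ) : 0 < total a b α β n := by
  rw [Ne, Prod.mk.injEq] at hαβ
  lia

theorem cast_total (hS : 0 < (a : ℝ) + b) (n : ℕ) :
    (total a b α β n : ℝ) = (((α : ℝ) + β) / ((a : ℝ) + b) + n) * ((a : ℝ) + b) := by
  push_cast
  field_simp

theorem div_add_pos (hS : 0 < (a : ℝ) + b) (hαβ : (α, β) ≠ (0, 0)) :
    0 < ((α : ℝ) + β) / ((a : ℝ) + b) := by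
  have : 0 < α + β := by simpa using total_pos (a := 0) (b := 0) hαβ 0
  exact div_pos (by exact_mod_cast this) hS

theorem growth_ratio_succ (hS : 0 < (a : ℝ) + b) (n : ℕ) :
    growth (((α : ℝ) + β) / ((a : ℝ) + b)) (ratio a b c) (n + 1) =
      growth (((α : ℝ) + β) / ((a : ℝ) + b)) (ratio a b c) n *
        (1 + ((a : ℝ) - c) / total a b α β n) := by
  rw [growth_succ, cast_total hS, ← ratio_mul_add hS, mul_div_mul_right _ _ hS.ne']

end Composition

section Fibers

variable {Ω β : Type*} [MeasurableSpace Ω] [MeasurableSpace β] [MeasurableSingletonClass β]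
  [Countable β] {P : Measure Ω} {X : Ω → β}

theorem ae_of_forall_ae_restrict_fiber (hX : Measurable X) {p : Ω → Prop}
    (h : ∀ ω₀, ∀ᵐ ω ∂P.restrict (X ⁻¹' {X ω₀}), p ω) : ∀ᵐ ω ∂P, p ω := by
  have hfiber (x : β) : ∀ᵐ ω ∂P, X ω = x → p ω := by
    by_cases hx : ∃ ω₀, X ω₀ = x
    · obtain ⟨ω₀, rfl⟩ := hx
      exact (ae_restrict_iff' (hX (.singleton _))).1 (h ω₀)
    · exact ae_of_all _ fun ω hω => (hx ⟨ω, hω⟩).elim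
  exact (ae_all_iff.2 hfiber).mono fun ω hω => hω _ rfl

theorem setIntegral_eq_of_forall_fiber (hX : Measurable X) {f g : Ω → ℝ} (hf : Integrable f P)
    (hg : Integrable g P)
    (h : ∀ ω₀, ∫ ω in X ⁻¹' {X ω₀}, f ω ∂P = ∫ ω in X ⁻¹' {X ω₀}, g ω ∂P) {s : Set Ω}
    (hs : MeasurableSet[MeasurableSpace.comap X inferInstance] s) :
    ∫ ω in s, f ω ∂P = ∫ ω in s, g ω ∂P := by
  obtain ⟨B, -, rfl⟩ := hs
  have hunion : X ⁻¹' B = ⋃ x : B, X ⁻¹' {(x : β)} := by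
    rw [← Set.preimage_iUnion, Set.iUnion_of_singleton_coe]
  have hmeas (x : B) : MeasurableSet (X ⁻¹' {(x : β)}) := hX (.singleton _)
  have hdisj : Pairwise (Function.onFun Disjoint fun x : B => X ⁻¹' {(x : β)}) := fun x y hxy =>
    Disjoint.preimage _ (Set.disjoint_singleton.2 (Subtype.coe_ne_coe.2 hxy))
  rw [hunion, integral_iUnion hmeas hdisj hf.integrableOn,
    integral_iUnion hmeas hdisj hg.integrableOn]
  refine tsum_congr fun x => ?_
  by_cases hx : ∃ ω₀, X ω₀ = x
  · obtain ⟨ω₀, hω₀⟩ := hx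
    exact hω₀ ▸ h ω₀
  · rw [Set.preimage_singleton_eq_empty.2 hx, setIntegral_empty, setIntegral_empty]

end Fibers

section Discrete

variable {Ω : Type*}

/-- The compositions up to time `n`. -/
def history (U : ℕ → Ω → ℕ × ℕ) (n : ℕ) (ω : Ω) (k : Set.Iic n) : ℕ × ℕ := U k ω

theorem history_preimage_singleton (U : ℕ → Ω → ℕ × ℕ) (n : ℕ) (ω₀ : Ω) :
    history U n ⁻¹' {history U n ω₀} = {ω | ∀ k ≤ n, U k ω = U k ω₀} := by
  ext ω
  simp [history, funext_iff]

variable [mΩ : MeasurableSpace Ω] {P : Measure Ω} {a b c d α β : ℕ} {U : ℕ → Ω → ℕ × ℕ}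

theorem measurable_history (hU : ∀ n, Measurable (U n)) (n : ℕ) : Measurable (history U n) :=
  measurable_pi_lambda _ fun k => hU k

namespace IsDiscreteTimeUrn

/-- The filtration generated by the compositions. -/
noncomputable def filtration (hU : IsDiscreteTimeUrn P a b c d α β U) : Filtration ℕ mΩ :=
  Filtration.natural U fun n => (hU.measurable n).stronglyMeasurable

theorem filtration_eq_comap_history (hU : IsDiscreteTimeUrn P a b c d α β U) (n : ℕ) :
    hU.filtration n = MeasurableSpace.comap (history U n) inferInstance :=
  Filtration.natural_eq_comap _ _ n

theorem stronglyMeasurable_comp (hU : IsDiscreteTimeUrn P a b c d α β U) (n : ℕ)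
    (g : ℕ × ℕ → ℝ) : StronglyMeasurable[hU.filtration n] fun ω => g (U n ω) :=
  (Measurable.of_discrete.comp
    (Filtration.stronglyAdapted_natural _ n).measurable).stronglyMeasurable

theorem measureReal_history_inter (hU : IsDiscreteTimeUrn P a b c d α β U) (n : ℕ) (ω₀ : Ω)
    (w : ℕ × ℕ) :
    P.real (history U n ⁻¹' {history U n ω₀} ∩ U (n + 1) ⁻¹' {w}) =
      P.real (history U n ⁻¹' {history U n ω₀}) * stepProb a b c d (U n ω₀) w := by
  let u : ℕ → ℕ × ℕ := Function.update (fun k => U k ω₀) (n + 1) w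
  have hu : u (n + 1) = w := Function.update_self _ _ _
  have hu_of_le {k : ℕ} (hk : k ≤ n) : u k = U k ω₀ := Function.update_of_ne (by lia) _ _
  have hpast : history U n ⁻¹' {history U n ω₀} = {ω | ∀ k ≤ n, U k ω = u k} := by
    rw [history_preimage_singleton]
    ext ω
    exact forall₂_congr fun k hk => by rw [hu_of_le hk]
  have hnext : history U n ⁻¹' {history U n ω₀} ∩ U (n + 1) ⁻¹' {w} =
      {ω | ∀ k ≤ n + 1, U k ω = u k} := by
    rw [hpast]
    ext ω
    simp only [Set.mem_inter_iff, Set.mem_ofPred_eq, Set.mem_preimage, Set.mem_singleton_iff,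
      Nat.le_succ_iff, or_imp, forall_and, forall_eq, hu]
  rw [hnext, hpast, hU.markov n u, hu, hu_of_le le_rfl]

variable [IsProbabilityMeasure P]

theorem map_restrict_history (hU : IsDiscreteTimeUrn P a b c d α β U) (n : ℕ) (ω₀ : Ω) :
    (P.restrict (history U n ⁻¹' {history U n ω₀})).map (U (n + 1)) =
      P (history U n ⁻¹' {history U n ω₀}) • drawLaw a b c d (U n ω₀) := by
  refine Measure.ext_of_singleton fun w => ?_
  rw [Measure.map_apply (hU.measurable _) (.singleton w),
    Measure.restrict_apply (hU.measurable _ (.singleton w)), Set.inter_comm,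
    ← ofReal_measureReal, hU.measureReal_history_inter, Measure.smul_apply, drawLaw_singleton,
    smul_eq_mul, ENNReal.ofReal_mul measureReal_nonneg, ofReal_measureReal]

theorem ae_step (hU : IsDiscreteTimeUrn P a b c d α β U) (n : ℕ) :
    ∀ᵐ ω ∂P, U (n + 1) ω = U n ω + (a, b) ∨ U (n + 1) ω = U n ω + (c, d) := by
  have hhistory := measurable_history hU.measurable n
  refine ae_of_forall_ae_restrict_fiber hhistory fun ω₀ => ?_
  have hdraw : ∀ᵐ w ∂(P.restrict (history U n ⁻¹' {history U n ω₀})).map (U (n + 1)),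
      w = U n ω₀ + (a, b) ∨ w = U n ω₀ + (c, d) := by
    rw [hU.map_restrict_history]
    exact Measure.ae_smul_measure (ae_drawLaw _) _
  filter_upwards [ae_of_ae_map (hU.measurable _).aemeasurable hdraw,
    ae_restrict_mem (hhistory (.singleton _))] with ω hω hpast
  rw [history_preimage_singleton] at hpast
  rwa [hpast n le_rfl]

theorem ae_total (hU : IsDiscreteTimeUrn P a b c d α β U) (hbalance : a + b = c + d) (n : ℕ) :
    ∀ᵐ ω ∂P, (U n ω).1 + (U n ω).2 = total a b α β n := by
  induction n with
  | zero => filter_upwards [hU.initial] with ω hω using by simp [hω]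
  | succ n ih =>
    filter_upwards [ih, hU.ae_step n] with ω hn hstep
    rcases hstep with hstep | hstep <;> simp only [hstep, Prod.fst_add, Prod.snd_add] <;> lia

theorem integrable_comp (hU : IsDiscreteTimeUrn P a b c d α β U) (hbalance : a + b = c + d)
    (n : ℕ) (g : ℕ × ℕ → ℝ) : Integrable (fun ω => g (U n ω)) P := by
  refine Integrable.of_bound ((hU.stronglyMeasurable_comp n g).mono
    (hU.filtration.le n)).aestronglyMeasurable
    (∑ v ∈ Finset.HasAntidiagonal.antidiagonal (total a b α β n), ‖g v‖) ?_
  filter_upwards [hU.ae_total hbalance n] with ω hω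
  exact Finset.single_le_sum (f := fun v => ‖g v‖) (fun _ _ => norm_nonneg _)
    (Finset.HasAntidiagonal.mem_antidiagonal.2 hω)

theorem setIntegral_succ (hU : IsDiscreteTimeUrn P a b c d α β U) (hbalance : a + b = c + d)
    (n : ℕ) (g : ℕ × ℕ → ℝ) {s : Set Ω} (hs : MeasurableSet[hU.filtration n] s) :
    ∫ ω in s, g (U (n + 1) ω) ∂P = ∫ ω in s, ∫ w, g w ∂(drawLaw a b c d (U n ω)) ∂P := by
  have hhistory := measurable_history hU.measurable n
  rw [hU.filtration_eq_comap_history] at hs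
  refine setIntegral_eq_of_forall_fiber hhistory (hU.integrable_comp hbalance (n + 1) g)
    (hU.integrable_comp hbalance n fun v => ∫ w, g w ∂(drawLaw a b c d v)) (fun ω₀ => ?_) hs
  have hconst : ∀ ω ∈ history U n ⁻¹' {history U n ω₀},
      ∫ w, g w ∂(drawLaw a b c d (U n ω)) = ∫ w, g w ∂(drawLaw a b c d (U n ω₀)) := by
    rw [history_preimage_singleton]
    exact fun ω hω => by rw [hω n le_rfl]
  rw [setIntegral_congr_fun (hhistory (.singleton _)) hconst, setIntegral_const,
    ← integral_map (hU.measurable _).aemeasurable Measurable.of_discrete.aestronglyMeasurable,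
    hU.map_restrict_history, integral_smul_measure, measureReal_def]

theorem martingale_u₂_div_growth (hU : IsDiscreteTimeUrn P a b c d α β U)
    (hbalance : a + b = c + d) (hσ : 0 < ratio a b c) (hαβ : (α, β) ≠ (0, 0)) :
    Martingale (fun n ω => u₂ a b c (U n ω) /
      growth (((α : ℝ) + β) / ((a : ℝ) + b)) (ratio a b c) n) hU.filtration P := by
  have hS := add_pos_of_ratio_pos hσ
  have hγ := growth_pos (div_add_pos hS hαβ) hσ.le
  refine martingale_of_setIntegral_eq_succ
    (fun n => hU.stronglyMeasurable_comp n fun v => u₂ a b c v / growth _ _ n)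
    (fun n => hU.integrable_comp hbalance n fun v => u₂ a b c v / growth _ _ n) fun n s hs => ?_
  rw [integral_div, integral_div, hU.setIntegral_succ hbalance n _ hs,
    div_eq_div_iff (hγ n).ne' (hγ (n + 1)).ne', growth_ratio_succ hS, mul_left_comm,
    mul_comm _ (growth _ _ n), ← integral_mul_const]
  congr 1
  refine setIntegral_congr_ae (hU.filtration.le n s hs) ?_
  filter_upwards [hU.ae_total hbalance n] with ω hω _
  have hT : ((U n ω).1 : ℝ) + (U n ω).2 = total a b α β n := by exact_mod_cast hω
  have hpos : (0 : ℝ) < total a b α β n := by exact_mod_cast total_pos hαβ n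
  rw [integral_u₂_drawLaw hbalance hS (hT ▸ hpos), hT]

theorem abs_u₂_div_growth_le (hU : IsDiscreteTimeUrn P a b c d α β U)
    (hbalance : a + b = c + d) (hσ : 0 < ratio a b c) (hαβ : (α, β) ≠ (0, 0)) :
    ∃ B, ∀ n, ∀ᵐ ω ∂P,
      |u₂ a b c (U n ω) / growth (((α : ℝ) + β) / ((a : ℝ) + b)) (ratio a b c) n| ≤
        B * ((n : ℝ) + 1) ^ (1 - ratio a b c) := by
  have hS := add_pos_of_ratio_pos hσ
  have hs := div_add_pos hS hαβ
  set s := ((α : ℝ) + β) / ((a : ℝ) + b) with hs_def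
  obtain ⟨κ, _, hκ_le⟩ := exists_add_one_rpow_le_mul_growth hs hσ.le
  refine ⟨(b + c) * (s + 1) * κ, fun n => ?_⟩
  filter_upwards [hU.ae_total hbalance n] with ω hω
  have hγ := growth_pos hs hσ.le n
  have hT : ((U n ω).1 : ℝ) + (U n ω).2 = total a b α β n := by exact_mod_cast hω
  rw [abs_div, abs_of_pos hγ, div_le_iff₀ hγ]
  calc |u₂ a b c (U n ω)| ≤ (b + c) / ((a : ℝ) + b) * ((s + n) * (a + b)) := by
        rw [hs_def, ← cast_total hS, ← hT]
        exact abs_u₂_le _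
    _ = (b + c) * (s + n) := by field_simp
    _ ≤ (b + c) * ((s + 1) * (n + 1)) := by gcongr; nlinarith [n.cast_nonneg (α := ℝ)]
    _ = (b + c) * (s + 1) *
          (((n : ℝ) + 1) ^ (1 - ratio a b c) * ((n : ℝ) + 1) ^ ratio a b c) := by
        rw [← Real.rpow_add (by positivity), sub_add_cancel, Real.rpow_one, mul_assoc]
    _ ≤ (b + c) * (s + 1) *
          (((n : ℝ) + 1) ^ (1 - ratio a b c) * (κ * growth s (ratio a b c) n)) := by
        gcongr
        exact hκ_le n
    _ = _ := by ring

theorem abs_u₂_div_growth_succ_sub_le (hU : IsDiscreteTimeUrn P a b c d α β U)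
    (hbalance : a + b = c + d) (hσ : 0 < ratio a b c) (hαβ : (α, β) ≠ (0, 0)) :
    ∃ C, ∀ n, ∀ᵐ ω ∂P,
      |u₂ a b c (U (n + 1) ω) / growth (((α : ℝ) + β) / ((a : ℝ) + b)) (ratio a b c) (n + 1) -
        u₂ a b c (U n ω) / growth (((α : ℝ) + β) / ((a : ℝ) + b)) (ratio a b c) n| ≤
        C * ((n : ℝ) + 1) ^ (-ratio a b c) := by
  have hS := add_pos_of_ratio_pos hσ
  have hs := div_add_pos hS hαβ
  obtain ⟨κ, hκ, hκ_le⟩ := exists_add_one_rpow_le_mul_growth hs hσ.le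
  refine ⟨ratio a b c * (b + c) * κ, fun n => ?_⟩
  filter_upwards [hU.ae_total hbalance n, hU.ae_step n] with ω hω hstep
  have hT : ((U n ω).1 : ℝ) + (U n ω).2 = total a b α β n := by exact_mod_cast hω
  have hpos : (0 : ℝ) < total a b α β n := by exact_mod_cast total_pos hαβ n
  have hincr := abs_u₂_draw_sub_le hbalance hσ (hT ▸ hpos) hstep
  have hsucc := growth_ratio_succ (a := a) (b := b) (c := c) (α := α) (β := β) hS n
  rw [← hT] at hsucc
  set γ := growth (((α : ℝ) + β) / ((a : ℝ) + b)) (ratio a b c)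
  have hγ (k : ℕ) : 0 < γ k := growth_pos hs hσ.le k
  have hfactor : u₂ a b c (U n ω) / γ n =
      u₂ a b c (U n ω) * (1 + ((a : ℝ) - c) / (((U n ω).1 : ℝ) + (U n ω).2)) / γ (n + 1) := by
    rw [div_eq_div_iff (hγ n).ne' (hγ (n + 1)).ne', hsucc]
    ring
  rw [hfactor, ← sub_div, abs_div, abs_of_pos (hγ (n + 1)), div_le_iff₀ (hγ (n + 1))]
  calc _ ≤ ratio a b c * (b + c) * 1 := by rwa [mul_one]
    _ = ratio a b c * (b + c) *
          (((n : ℝ) + 1) ^ (-ratio a b c) * ((n : ℝ) + 1) ^ ratio a b c) := by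
        rw [← Real.rpow_add (by positivity), neg_add_cancel, Real.rpow_zero]
    _ ≤ ratio a b c * (b + c) * (((n : ℝ) + 1) ^ (-ratio a b c) * (κ * γ (n + 1))) := by
        gcongr
        exact (hκ_le n).trans (mul_le_mul_of_nonneg_left (growth_le_growth_succ hs hσ.le n) hκ)
    _ = _ := by ring

theorem exists_limit_isSubWeibull (hU : IsDiscreteTimeUrn P a b c d α β U)
    (hbalance : a + b = c + d) (hσ : 1 / 2 < ratio a b c) (hαβ : (α, β) ≠ (0, 0)) :
    ∃ W : Ω → ℝ, IsDiscreteTimeLimit P a b c U W ∧ IsSubWeibull W (1 - ratio a b c) P := by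
  have hσ_pos : 0 < ratio a b c := by linarith
  have hs := div_add_pos (add_pos_of_ratio_pos hσ_pos) hαβ
  obtain ⟨B, hB⟩ := hU.abs_u₂_div_growth_le hbalance hσ_pos hαβ
  obtain ⟨C, hC⟩ := hU.abs_u₂_div_growth_succ_sub_le hbalance hσ_pos hαβ
  obtain ⟨L, hL, hlim, htail⟩ := exists_tendsto_isSubWeibull_of_martingale
    (hU.martingale_u₂_div_growth hbalance hσ_pos hαβ) hσ ratio_le_one hB hC
  set s := ((α : ℝ) + β) / ((a : ℝ) + b)
  refine ⟨fun ω => Real.Gamma s / Real.Gamma (s + ratio a b c) * L ω, ⟨hL.const_mul _, ?_⟩,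
    htail.const_mul _⟩
  filter_upwards [hlim] with ω hω
  refine ((tendsto_growth_div_rpow hs hσ_pos.le).mul hω).congr fun n => ?_
  have := growth_pos hs hσ_pos.le n
  field_simp

theorem exists_limit_isDeterminedByMoments (hU : IsDiscreteTimeUrn P a b c d α β U)
    (hbalance : a + b = c + d) (hσ : 1 / 2 < ratio a b c) (hαβ : (α, β) ≠ (0, 0)) :
    ∃ W : Ω → ℝ, IsDiscreteTimeLimit P a b c U W ∧ IsDeterminedByMoments (P.map W) := by
  obtain ⟨W, hW, htail⟩ := hU.exists_limit_isSubWeibull hbalance hσ hαβ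
  exact ⟨W, hW, (htail.mono (by linarith)).isDeterminedByMoments_map hW.1.aemeasurable⟩

end IsDiscreteTimeUrn
end Discrete

section Exponential

theorem ae_nonneg_expMeasure (r : ℝ) : ∀ᵐ x ∂(expMeasure r), 0 ≤ x := by
  refine (ae_withDensity_iff (measurable_gammaPDFReal 1 r).ennreal_ofReal).2 (ae_of_all _ ?_)
  exact fun x hx => not_lt.1 fun hneg => hx (gammaPDF_of_neg hneg)

instance nullSingletonClass_expMeasure (r : ℝ) : NullSingletonClass (expMeasure r) :=
  ⟨fun _ => withDensity_absolutelyContinuous _ _ (measure_singleton _)⟩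

theorem expMeasure_real_Ioi {r : ℝ} (hr : 0 < r) (x : ℝ) :
    (expMeasure r).real (Set.Ioi x) = if 0 ≤ x then Real.exp (-(r * x)) else 1 := by
  have := isProbabilityMeasure_expMeasure hr
  rw [← Set.compl_Iic, probReal_compl_eq_one_sub measurableSet_Iic, ← cdf_eq_real,
    cdf_expMeasure_eq hr]
  split_ifs <;> ring

theorem integral_exp_neg_expMeasure {r s : ℝ} (hr : 0 < r) (hs : 0 ≤ s) :
    ∫ x, Real.exp (-s * x) ∂(expMeasure r) = r / (r + s) := by
  have htilt (x : ℝ) : exponentialPDF r x * ENNReal.ofReal (Real.exp (-s * x)) =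
      ENNReal.ofReal (r / (r + s)) * exponentialPDF (r + s) x := by
    rcases lt_or_ge x 0 with hx | hx
    · rw [exponentialPDF_of_neg hx, exponentialPDF_of_neg hx, zero_mul, mul_zero]
    · rw [exponentialPDF_of_nonneg hx, exponentialPDF_of_nonneg hx,
        ← ENNReal.ofReal_mul (by positivity), ← ENNReal.ofReal_mul (by positivity), mul_assoc,
        ← Real.exp_add, ← mul_assoc, div_mul_cancel₀ _ (by positivity)]
      ring_nf
  have hmeas (q : ℝ) : Measurable (exponentialPDF q) :=
    (measurable_exponentialPDFReal q).ennreal_ofReal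
  have hdensity : expMeasure r = volume.withDensity (exponentialPDF r) := rfl
  rw [integral_eq_lintegral_of_nonneg_ae (ae_of_all _ fun _ => (Real.exp_pos _).le)
    (by fun_prop), hdensity, lintegral_withDensity_eq_lintegral_mul _ (hmeas r) (by fun_prop)]
  simp only [Pi.mul_apply, htilt]
  rw [lintegral_const_mul _ (hmeas (r + s)), lintegral_exponentialPDF_eq_one (by positivity),
    mul_one, ENNReal.toReal_ofReal (by positivity)]

end Exponential

section Clocks

variable {Ω : Type*} [MeasurableSpace Ω] {P : Measure Ω}

theorem ae_ne_of_indepFun {X Y : Ω → ℝ} [IsFiniteMeasure P] [NullSingletonClass (P.map Y)]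
    (hX : Measurable X) (hY : Measurable Y) (hXY : IndepFun X Y P) : ∀ᵐ ω ∂P, X ω ≠ Y ω := by
  have hdiag : MeasurableSet {p : ℝ × ℝ | p.1 = p.2} :=
    measurableSet_eq_fun measurable_fst measurable_snd
  have hnull : (P.map X).prod (P.map Y) {p : ℝ × ℝ | p.1 = p.2} = 0 := by
    refine (Measure.measure_prod_null hdiag).2 (ae_of_all _ fun x => ?_)
    have hfiber : Prod.mk x ⁻¹' {p : ℝ × ℝ | p.1 = p.2} = {x} := by
      ext y
      simp [eq_comm]
    simp only [hfiber, Pi.zero_apply, measure_singleton]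
  rw [← (indepFun_iff_map_prod_eq_prod_map_map hX.aemeasurable hY.aemeasurable).1 hXY,
    Measure.map_apply (hX.prodMk hY) hdiag] at hnull
  exact measure_eq_zero_iff_ae_notMem.1 hnull

variable {ι : Type*} {E : ι → Ω → ℝ}

theorem map_reindex_eq_of_iIndepFun [Finite ι] {μ : Measure ℝ} (hE : ∀ j, Measurable (E j))
    (hlaw : ∀ j, P.map (E j) = μ) (hindep : iIndepFun E P) (e : Equiv.Perm ι) :
    P.map (fun ω j => E (e j) ω) = P.map (fun ω j => E j ω) := by
  have := Fintype.ofFinite ι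
  rw [(hindep.precomp e.injective).map_fun_eq_pi_map fun j => (hE (e j)).aemeasurable,
    hindep.map_fun_eq_pi_map fun j => (hE j).aemeasurable]
  simp only [hlaw]

/-- The configurations of clocks in which clock `j` rings first, possibly together with others. -/
def ringsFirst (j : ι) : Set (ι → ℝ) := {x | ∀ i, x j ≤ x i}

theorem measurableSet_ringsFirst [Countable ι] (j : ι) : MeasurableSet (ringsFirst j) := by
  rw [ringsFirst, Set.ofPred_forall]
  exact MeasurableSet.iInter fun i =>
    measurableSet_le (measurable_pi_apply j) (measurable_pi_apply i)

theorem measureReal_ringsFirst_eq [Finite ι] {μ : Measure ℝ} (hE : ∀ j, Measurable (E j))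
    (hlaw : ∀ j, P.map (E j) = μ) (hindep : iIndepFun E P) (j j' : ι) :
    P.real {ω | ∀ i, E j ω ≤ E i ω} = P.real {ω | ∀ i, E j' ω ≤ E i ω} := by
  classical
  have hmap (e : Equiv.Perm ι) : P.real {ω | ∀ i, E (e j) ω ≤ E (e i) ω} =
      (P.map fun ω i => E (e i) ω).real (ringsFirst j) :=
    (map_measureReal_apply (measurable_pi_lambda _ fun i => hE (e i))
      (measurableSet_ringsFirst j)).symm
  have hswap (ω : Ω) : (∀ i, E j' ω ≤ E i ω) ↔
      ∀ i, E (Equiv.swap j j' j) ω ≤ E (Equiv.swap j j' i) ω := by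
    rw [Equiv.swap_apply_left, (Equiv.swap j j').forall_congr_right (q := fun i => E j' ω ≤ E i ω)]
  simp only [hswap]
  rw [hmap (Equiv.swap j j'), map_reindex_eq_of_iIndepFun hE hlaw hindep]
  exact hmap (Equiv.refl ι)

variable [Fintype ι] [Nonempty ι]

theorem measureReal_exists_mem_ringsFirst [IsProbabilityMeasure P] {μ : Measure ℝ}
    [NullSingletonClass μ] (hE : ∀ j, Measurable (E j)) (hlaw : ∀ j, P.map (E j) = μ)
    (hindep : iIndepFun E P) (J : Finset ι) :
    P.real {ω | ∃ j ∈ J, ∀ i, E j ω ≤ E i ω} = J.card / Fintype.card ι := by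
  have hmeas (j : ι) : MeasurableSet {ω | ∀ i, E j ω ≤ E i ω} :=
    measurable_pi_lambda _ hE (measurableSet_ringsFirst j)
  have hdisj (i j : ι) (hij : i ≠ j) :
      AEDisjoint P {ω | ∀ k, E i ω ≤ E k ω} {ω | ∀ k, E j ω ≤ E k ω} := by
    have : NullSingletonClass (P.map (E j)) := hlaw j ▸ ‹NullSingletonClass μ›
    refine measure_mono_null ?_ (ae_iff.1 (ae_ne_of_indepFun (hE i) (hE j) (hindep.indepFun hij)))
    exact fun ω hω => not_not.2 (le_antisymm (hω.1 j) (hω.2 i))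
  obtain ⟨j₀⟩ := ‹Nonempty ι›
  have hsum (J : Finset ι) : P.real {ω | ∃ j ∈ J, ∀ i, E j ω ≤ E i ω} =
      J.card * P.real {ω | ∀ i, E j₀ ω ≤ E i ω} := by
    rw [← nsmul_eq_mul, ← Finset.sum_const, ← Finset.sum_congr rfl fun j _ =>
      measureReal_ringsFirst_eq hE hlaw hindep j j₀, ← measureReal_biUnion_finset₀
      (fun i _ j _ hij => hdisj i j hij) fun j _ => (hmeas j).nullMeasurableSet]
    congr 1
    ext ω
    simp
  have hexists : {ω | ∃ j ∈ Finset.univ, ∀ i, E j ω ≤ E i ω} = Set.univ :=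
    Set.eq_univ_of_forall fun ω => by
      have : Nonempty ι := ⟨j₀⟩
      simpa using Finite.exists_min fun j => E j ω
  have huniv := hsum Finset.univ
  rw [hexists, probReal_univ, Finset.card_univ] at huniv
  rw [hsum, eq_div_iff (by rintro h; simp [h] at huniv), mul_assoc,
    mul_comm _ (Fintype.card ι : ℝ), ← huniv, mul_one]

theorem map_iInf_eq_expMeasure [IsProbabilityMeasure P] {r : ℝ} (hr : 0 < r)
    (hE : ∀ j, Measurable (E j)) (hlaw : ∀ j, P.map (E j) = expMeasure r)
    (hindep : iIndepFun E P) :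
    P.map (fun ω => ⨅ j, E j ω) = expMeasure (Fintype.card ι * r) := by
  have hrate : 0 < Fintype.card ι * r := by positivity
  have hmin : Measurable fun ω => ⨅ j, E j ω := Measurable.iInf hE
  have := isProbabilityMeasure_expMeasure hrate
  have : IsProbabilityMeasure (P.map fun ω => ⨅ j, E j ω) :=
    Measure.isProbabilityMeasure_map hmin.aemeasurable
  have htail (x : ℝ) : (P.map fun ω => ⨅ j, E j ω).real (Set.Ioi x) =
      (expMeasure (Fintype.card ι * r)).real (Set.Ioi x) := by
    have hpreimage : (fun ω => ⨅ j, E j ω) ⁻¹' Set.Ioi x =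
        ⋂ j ∈ Finset.univ, E j ⁻¹' Set.Ioi x := by
      ext ω
      simp [iInf, (Set.finite_range _).lt_csInf_iff (Set.range_nonempty _)]
    rw [map_measureReal_apply hmin measurableSet_Ioi, hpreimage, measureReal_def,
      hindep.measure_inter_preimage_eq_mul Finset.univ fun _ _ => measurableSet_Ioi,
      ENNReal.toReal_prod]
    simp only [← Measure.map_apply (hE _) measurableSet_Ioi, hlaw, ← measureReal_def,
      expMeasure_real_Ioi hr, expMeasure_real_Ioi hrate, Finset.prod_const, Finset.card_univ]
    split_ifs
    · rw [← Real.exp_nat_mul]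
      ring_nf
    · exact one_pow _
  refine Measure.eq_of_cdf _ _ (StieltjesFunction.ext fun x => ?_)
  have hx := htail x
  rw [← Set.compl_Iic, probReal_compl_eq_one_sub measurableSet_Iic,
    probReal_compl_eq_one_sub measurableSet_Iic] at hx
  rw [cdf_eq_real, cdf_eq_real]
  linarith

theorem integral_exp_neg_iInf [IsProbabilityMeasure P] {r s : ℝ} (hr : 0 < r) (hs : 0 ≤ s)
    (hE : ∀ j, Measurable (E j)) (hlaw : ∀ j, P.map (E j) = expMeasure r)
    (hindep : iIndepFun E P) :
    ∫ ω, Real.exp (-s * ⨅ j, E j ω) ∂P = Fintype.card ι * r / (Fintype.card ι * r + s) := by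
  rw [← integral_exp_neg_expMeasure (by positivity) hs, ← map_iInf_eq_expMeasure hr hE hlaw hindep,
    integral_map (Measurable.iInf hE).aemeasurable (by fun_prop)]

end Clocks

section ClockSigmaAlgebra

variable {Ω ι : Type*} [Countable ι] {E : ι → Ω → ℝ}

theorem measurableSet_comap_exists_mem_ringsFirst (J : Finset ι) :
    MeasurableSet[MeasurableSpace.comap (fun ω j => E j ω) MeasurableSpace.pi]
      {ω | ∃ j ∈ J, ∀ i, E j ω ≤ E i ω} := by
  refine ⟨⋃ j ∈ J, ringsFirst j,
    Finset.measurableSet_biUnion _ fun j _ => measurableSet_ringsFirst j, ?_⟩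
  ext ω
  simp [ringsFirst]

theorem measurable_comap_iInf :
    Measurable[MeasurableSpace.comap (fun ω j => E j ω) MeasurableSpace.pi]
      fun ω => ⨅ j, E j ω :=
  (Measurable.iInf measurable_pi_apply).comp (comap_measurable fun ω j => E j ω)

end ClockSigmaAlgebra

theorem prod_range_succ_add_mul {M : Type*} [CommMonoid M] (f : ℕ → M) (k n : ℕ) :
    (∏ i ∈ Finset.range k, f (n + 1 + i)) * f n =
      (∏ i ∈ Finset.range k, f (n + i)) * f (n + k) := by
  rw [← Finset.prod_range_succ fun i => f (n + i), Finset.prod_range_succ']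
  simp only [add_zero, add_assoc, add_comm 1]

theorem integrable_exp_neg_mul {Ω : Type*} [MeasurableSpace Ω] {P : Measure Ω} [IsFiniteMeasure P]
    {X : Ω → ℝ} (hX : AEMeasurable X P) (hX_nonneg : ∀ᵐ ω ∂P, 0 ≤ X ω) {s : ℝ} (hs : 0 ≤ s) :
    Integrable (fun ω => Real.exp (-s * X ω)) P := by
  refine .of_bound (hX.const_mul (-s)).exp.aestronglyMeasurable 1 (hX_nonneg.mono fun ω hω => ?_)
  rw [Real.norm_eq_abs, Real.abs_exp, Real.exp_le_one_iff, neg_mul, neg_nonpos]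
  positivity

section Composition

variable {a b c d : ℕ}

theorem card_filter_draw_div {T : ℕ} {v : ℕ × ℕ} (hv : v.1 + v.2 = T) (w : ℕ × ℕ) :
    ((Finset.univ.filter fun j : Fin T =>
      w = v + if (j : ℕ) < v.1 then (a, b) else (c, d)).card : ℝ) / T = stepProb a b c d v w := by
  subst hv
  rw [Finset.card_filter, Nat.cast_sum, Fin.sum_univ_add, stepProb, Nat.cast_add]
  simp only [Fin.val_castAdd, Fin.is_lt, if_true, Fin.val_natAdd, add_lt_iff_neg_left,
    not_lt_zero, if_false, Nat.cast_ite, Nat.cast_one, Nat.cast_zero, Finset.sum_const,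
    Finset.card_univ, Fintype.card_fin, nsmul_eq_mul]
  ring

theorem cast_total_add (a b α β n k : ℕ) :
    (total a b α β n : ℝ) + k * ((a : ℝ) + b) = total a b α β (n + k) := by
  push_cast
  ring

/-- The total number of balls `T_n` just after the `n`-th ring, discounted by its mean growth:
`T_n e ^ (-S τ_n)`. Its limit converts powers of the ringing time into powers of `n`. -/
noncomputable def discountedTotal {Ω : Type*} (a b α β : ℕ) (τ : ℕ → Ω → ℝ) (n : ℕ) (ω : Ω) : ℝ :=
  total a b α β n * Real.exp (-((a : ℝ) + b) * τ n ω)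

theorem discountedTotal_nonneg {Ω : Type*} {α β : ℕ} {τ : ℕ → Ω → ℝ} (n : ℕ) (ω : Ω) :
    0 ≤ discountedTotal a b α β τ n ω := by
  rw [discountedTotal]
  positivity

theorem discountedTotal_pow {Ω : Type*} {α β : ℕ} {τ : ℕ → Ω → ℝ} (n : ℕ) (ω : Ω) (k : ℕ) :
    discountedTotal a b α β τ n ω ^ k =
      (total a b α β n : ℝ) ^ k * Real.exp (-(k * ((a : ℝ) + b)) * τ n ω) := by
  rw [discountedTotal, mul_pow, ← Real.exp_nat_mul]
  ring_nf

end Composition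

namespace IsClockedUrn

variable {Ω : Type*} [mΩ : MeasurableSpace Ω] {P : Measure Ω}
  {a b c d α β : ℕ} {ℱ : Filtration ℕ mΩ} {V : ℕ → Ω → ℕ × ℕ} {τ : ℕ → Ω → ℝ}
  {E : ∀ n : ℕ, Fin (total a b α β n) → Ω → ℝ}

theorem ae_total (h : IsClockedUrn P a b c d α β ℱ V τ E) (hbalance : a + b = c + d) (n : ℕ) :
    ∀ᵐ ω ∂P, (V n ω).1 + (V n ω).2 = total a b α β n := by
  induction n with
  | zero => filter_upwards [h.initial_V] with ω hω using by simp [hω]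
  | succ n ih =>
    filter_upwards [ih, h.ring] with ω hn hring
    obtain ⟨j, -, -, hdraw⟩ := hring n
    rw [hdraw]
    split_ifs <;> simp only [Prod.fst_add, Prod.snd_add] <;> lia

theorem measurableSet_past (h : IsClockedUrn P a b c d α β ℱ V τ E) (u : ℕ → ℕ × ℕ) (n : ℕ) :
    MeasurableSet[ℱ n] {ω | ∀ k ≤ n, V k ω = u k} := by
  simp only [Set.ofPred_forall]
  exact MeasurableSet.iInter fun k => MeasurableSet.iInter fun hk =>
    ℱ.mono hk _ (h.measurable_V k (.singleton (u k)))

theorem ae_time_succ (h : IsClockedUrn P a b c d α β ℱ V τ E) (n : ℕ) :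
    ∀ᵐ ω ∂P, τ (n + 1) ω = τ n ω + ⨅ j, E n j ω := by
  filter_upwards [h.ring] with ω hring
  obtain ⟨j, hj, hτ, -⟩ := hring n
  have : Nonempty (Fin (total a b α β n)) := ⟨j⟩
  rw [hτ, (ciInf_le (Set.finite_range _).bddBelow j).antisymm (le_ciInf hj)]

theorem ae_iInf_nonneg (h : IsClockedUrn P a b c d α β ℱ V τ E) (n : ℕ) :
    ∀ᵐ ω ∂P, 0 ≤ ⨅ j, E n j ω := by
  have hclock (j : Fin (total a b α β n)) : ∀ᵐ ω ∂P, 0 ≤ E n j ω :=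
    ae_of_ae_map (h.measurable_E n j).aemeasurable (h.clocks_exp n j ▸ ae_nonneg_expMeasure 1)
  exact (ae_all_iff.2 hclock).mono fun ω hω => Real.iInf_nonneg hω

theorem ae_time_nonneg (h : IsClockedUrn P a b c d α β ℱ V τ E) (n : ℕ) :
    ∀ᵐ ω ∂P, 0 ≤ τ n ω := by
  induction n with
  | zero => exact h.initial_τ.mono fun ω hω => hω.ge
  | succ n ih =>
    filter_upwards [ih, h.ae_time_succ n, h.ae_iInf_nonneg n] with ω hn hsucc hmin
    exact hsucc ▸ add_nonneg hn hmin

variable [IsProbabilityMeasure P]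

theorem ae_succ_eq_iff (h : IsClockedUrn P a b c d α β ℱ V τ E) (n : ℕ) :
    ∀ᵐ ω ∂P, ∀ w, V (n + 1) ω = w ↔
      ∃ j : Fin (total a b α β n), w = V n ω + (if (j : ℕ) < (V n ω).1 then (a, b) else (c, d)) ∧
        ∀ i, E n j ω ≤ E n i ω := by
  have hne (i j : Fin (total a b α β n)) : ∀ᵐ ω ∂P, i ≠ j → E n i ω ≠ E n j ω := by
    by_cases hij : i = j
    · exact ae_of_all _ fun _ hne => absurd hij hne
    · have : NullSingletonClass (P.map (E n j)) := by rw [h.clocks_exp n j]; infer_instance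
      filter_upwards [ae_ne_of_indepFun (h.measurable_E n i) (h.measurable_E n j)
        ((h.clocks_indep n).indepFun hij)] with ω hω _ using hω
  filter_upwards [h.ring, ae_all_iff.2 fun i => ae_all_iff.2 (hne i)] with ω hring hdistinct w
  obtain ⟨j, hj, -, hdraw⟩ := hring n
  refine ⟨fun hw => ⟨j, hw.symm.trans hdraw, hj⟩, ?_⟩
  rintro ⟨i, rfl, hi⟩
  obtain rfl : i = j := not_not.1 fun hij => hdistinct i j hij (le_antisymm (hi j) (hj i))
  exact hdraw

theorem measureReal_exists_draw (h : IsClockedUrn P a b c d α β ℱ V τ E)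
    (hαβ : (α, β) ≠ (0, 0)) {n : ℕ} {v : ℕ × ℕ} (hv : v.1 + v.2 = total a b α β n) (w : ℕ × ℕ) :
    P.real {ω | ∃ j ∈ Finset.univ.filter fun j : Fin (total a b α β n) =>
        w = v + if (j : ℕ) < v.1 then (a, b) else (c, d), ∀ i, E n j ω ≤ E n i ω} =
      stepProb a b c d v w := by
  have : Nonempty (Fin (total a b α β n)) := Fin.pos_iff_nonempty.1 (total_pos hαβ n)
  rw [measureReal_exists_mem_ringsFirst (h.measurable_E n) (h.clocks_exp n) (h.clocks_indep n),
    Fintype.card_fin, card_filter_draw_div hv]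

theorem isDiscreteTimeUrn (h : IsClockedUrn P a b c d α β ℱ V τ E)
    (hbalance : a + b = c + d) (hαβ : (α, β) ≠ (0, 0)) :
    IsDiscreteTimeUrn P a b c d α β V := by
  refine ⟨fun n => (h.measurable_V n).mono (ℱ.le n) le_rfl, h.initial_V, fun n u => ?_⟩
  set past := {ω | ∀ k ≤ n, V k ω = u k} with hpast
  set draw := {ω | ∃ j ∈ Finset.univ.filter fun j : Fin (total a b α β n) =>
    u (n + 1) = u n + if (j : ℕ) < (u n).1 then (a, b) else (c, d),
    ∀ i, E n j ω ≤ E n i ω} with hdraw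
  have hnext : {ω | ∀ k ≤ n + 1, V k ω = u k} =ᵐ[P] (past ∩ draw : Set Ω) := by
    refine eventuallyEq_set.2 ?_
    filter_upwards [h.ae_succ_eq_iff n] with ω hω
    simp only [hpast, hdraw, Set.mem_inter_iff, Set.mem_ofPred_eq, Nat.le_succ_iff, or_imp,
      forall_and, forall_eq, hω, Finset.mem_filter, Finset.mem_univ, true_and]
    exact and_congr_right fun hu => by rw [hu n le_rfl]
  have hindep : P.real (past ∩ draw) = P.real past * P.real draw := by
    rw [Set.inter_comm, measureReal_def, (Indep_iff _ _ _).1 (h.clocks_indep_past n) draw past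
      (measurableSet_comap_exists_mem_ringsFirst _) (h.measurableSet_past u n),
      ENNReal.toReal_mul, mul_comm, ← measureReal_def, ← measureReal_def]
  rw [measureReal_congr hnext, hindep]
  by_cases hnull : P past = 0
  · rw [measureReal_def, hnull, ENNReal.toReal_zero, zero_mul, zero_mul]
  · obtain ⟨ω, hω, hT⟩ :=
      ((frequently_ae_mem_iff.2 hnull).and_eventually (h.ae_total hbalance n)).exists
    rw [hω n le_rfl] at hT
    rw [h.measureReal_exists_draw hαβ hT]

theorem integrable_exp_neg_time (h : IsClockedUrn P a b c d α β ℱ V τ E) (n : ℕ) {s : ℝ}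
    (hs : 0 ≤ s) : Integrable (fun ω => Real.exp (-s * τ n ω)) P :=
  integrable_exp_neg_mul ((h.measurable_τ n).mono (ℱ.le n) le_rfl).aemeasurable
    (h.ae_time_nonneg n) hs

theorem condExp_exp_neg_time_succ (h : IsClockedUrn P a b c d α β ℱ V τ E)
    (hαβ : (α, β) ≠ (0, 0)) (n : ℕ) {s : ℝ} (hs : 0 ≤ s) :
    P[fun ω => Real.exp (-s * τ (n + 1) ω) | ℱ n] =ᵐ[P]
      fun ω => Real.exp (-s * τ n ω) * (total a b α β n / (total a b α β n + s)) := by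
  have hsplit : (fun ω => Real.exp (-s * τ (n + 1) ω)) =ᵐ[P]
      (fun ω => Real.exp (-s * τ n ω)) * fun ω => Real.exp (-s * ⨅ j, E n j ω) := by
    filter_upwards [h.ae_time_succ n] with ω hω
    rw [hω, mul_add, Real.exp_add, Pi.mul_apply]
  have hclocks := (measurable_pi_lambda _ (h.measurable_E n)).comap_le
  have hmin : Integrable (fun ω => Real.exp (-s * ⨅ j, E n j ω)) P :=
    integrable_exp_neg_mul (measurable_comap_iInf.mono hclocks le_rfl).aemeasurable
      (h.ae_iInf_nonneg n) hs
  have hindep := condExp_indep_eq hclocks (ℱ.le n)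
    (measurable_comap_iInf.const_mul (-s)).exp.stronglyMeasurable (h.clocks_indep_past n)
  have hpull := condExp_mul_of_stronglyMeasurable_left
    ((h.measurable_τ n).const_mul (-s)).exp.stronglyMeasurable
    ((h.integrable_exp_neg_time (n + 1) hs).congr hsplit) hmin
  have : Nonempty (Fin (total a b α β n)) := Fin.pos_iff_nonempty.1 (total_pos hαβ n)
  filter_upwards [condExp_congr_ae (m := ℱ n) hsplit, hpull, hindep] with ω hω hω' hω''
  rw [hω, hω', Pi.mul_apply, hω'', integral_exp_neg_iInf one_pos hs (h.measurable_E n)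
    (h.clocks_exp n) (h.clocks_indep n), Fintype.card_fin, mul_one]

theorem integral_exp_neg_time_succ (h : IsClockedUrn P a b c d α β ℱ V τ E)
    (hαβ : (α, β) ≠ (0, 0)) (n : ℕ) {s : ℝ} (hs : 0 ≤ s) :
    ∫ ω, Real.exp (-s * τ (n + 1) ω) ∂P =
      (∫ ω, Real.exp (-s * τ n ω) ∂P) * (total a b α β n / (total a b α β n + s)) := by
  rw [← integral_condExp (ℱ.le n), integral_congr_ae (h.condExp_exp_neg_time_succ hαβ n hs),
    integral_mul_const]

theorem prod_mul_integral_exp_neg_time (h : IsClockedUrn P a b c d α β ℱ V τ E)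
    (hαβ : (α, β) ≠ (0, 0)) (k n : ℕ) :
    (∏ i ∈ Finset.range k, (total a b α β (n + i) : ℝ)) *
      ∫ ω, Real.exp (-(k * ((a : ℝ) + b)) * τ n ω) ∂P =
      ∏ i ∈ Finset.range k, (total a b α β i : ℝ) := by
  induction n with
  | zero =>
    have hinit : ∫ ω, Real.exp (-(k * ((a : ℝ) + b)) * τ 0 ω) ∂P = ∫ _, (1 : ℝ) ∂P :=
      integral_congr_ae (h.initial_τ.mono fun ω hω => by simp [hω])
    rw [hinit]
    simp
  | succ n ih =>
    have hT : (total a b α β (n + k) : ℝ) ≠ 0 := Nat.cast_ne_zero.2 (total_pos hαβ _).ne'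
    have hshift := prod_range_succ_add_mul (fun i => (total a b α β i : ℝ)) k n
    rw [h.integral_exp_neg_time_succ hαβ n (by positivity), cast_total_add, ← ih]
    field_simp
    linear_combination (∫ ω, Real.exp (-(k * ((a : ℝ) + b) * τ n ω)) ∂P) * hshift

theorem integrable_discountedTotal_pow (h : IsClockedUrn P a b c d α β ℱ V τ E) (k n : ℕ) :
    Integrable (fun ω => discountedTotal a b α β τ n ω ^ k) P := by
  simp only [discountedTotal_pow]
  exact (h.integrable_exp_neg_time n (by positivity)).const_mul _

theorem integral_discountedTotal_pow_le (h : IsClockedUrn P a b c d α β ℱ V τ E)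
    (hαβ : (α, β) ≠ (0, 0)) (k n : ℕ) :
    ∫ ω, discountedTotal a b α β τ n ω ^ k ∂P ≤ ((total a b α β 1 : ℝ) * k) ^ k := by
  simp only [discountedTotal_pow]
  rw [integral_const_mul]
  calc _ ≤ (∏ i ∈ Finset.range k, (total a b α β (n + i) : ℝ)) *
        ∫ ω, Real.exp (-(k * ((a : ℝ) + b)) * τ n ω) ∂P := by
        have hpow : (total a b α β n : ℝ) ^ k = ∏ _i ∈ Finset.range k, (total a b α β n : ℝ) := by
          simp
        rw [hpow]
        have : 0 ≤ ∫ ω, Real.exp (-(k * ((a : ℝ) + b)) * τ n ω) ∂P :=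
          integral_nonneg fun _ => (Real.exp_pos _).le
        gcongr
        exact Nat.add_le_add_left (Nat.mul_le_mul_right _ (Nat.le_add_right _ _)) _
    _ = ∏ i ∈ Finset.range k, (total a b α β i : ℝ) := h.prod_mul_integral_exp_neg_time hαβ k n
    _ ≤ ∏ _i ∈ Finset.range k, ((total a b α β 1 : ℝ) * k) := by
        refine Finset.prod_le_prod (fun _ _ => by positivity) fun i hi => ?_
        have : total a b α β i ≤ total a b α β 1 * k := by
          have : i + 1 ≤ k := Finset.mem_range.1 hi
          simp only [total]
          nlinarith
        exact_mod_cast this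
    _ = _ := by rw [Finset.prod_const, Finset.card_range]

theorem measureReal_lt_discountedTotal_le (h : IsClockedUrn P a b c d α β ℱ V τ E)
    (hαβ : (α, β) ≠ (0, 0)) {N : ℕ} (hN : N ≠ 0) (n : ℕ) :
    P.real {ω | Real.exp 1 * total a b α β 1 * N < |discountedTotal a b α β τ n ω|} ≤
      Real.exp (-N) := by
  have hT : (0 : ℝ) < total a b α β 1 := Nat.cast_pos.2 (total_pos hαβ 1)
  have : (0 : ℝ) < N := Nat.cast_pos.2 (Nat.pos_of_ne_zero hN)
  set y := Real.exp 1 * total a b α β 1 * N with hy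
  have hy_pos : 0 < y := by positivity
  have hmarkov : y ^ N * P.real {ω | y ^ N ≤ discountedTotal a b α β τ n ω ^ N} ≤
      (total a b α β 1 * N) ^ N :=
    (mul_meas_ge_le_integral_of_nonneg
      (ae_of_all P fun ω => pow_nonneg (discountedTotal_nonneg n ω) N)
      (h.integrable_discountedTotal_pow N n) _).trans (h.integral_discountedTotal_pow_le hαβ N n)
  have hpow : (total a b α β 1 * N : ℝ) ^ N = y ^ N * Real.exp (-N) := by
    rw [hy, mul_assoc, mul_pow (Real.exp 1), ← Real.exp_nat_mul, mul_right_comm, ← Real.exp_add]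
    simp
  refine (measureReal_mono ?_).trans (le_of_mul_le_mul_left (hmarkov.trans_eq hpow) (by positivity))
  refine Set.ofPred_subset_ofPred_of_imp fun ω hω => pow_le_pow_left₀ hy_pos.le ?_ N
  rw [abs_of_nonneg (discountedTotal_nonneg n ω)] at hω
  exact hω.le

theorem martingale_discountedTotal (h : IsClockedUrn P a b c d α β ℱ V τ E)
    (hαβ : (α, β) ≠ (0, 0)) : Martingale (discountedTotal a b α β τ) ℱ P := by
  refine martingale_nat
    (fun n => (((h.measurable_τ n).const_mul _).exp.const_mul _).stronglyMeasurable)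
    (fun n => by simpa using h.integrable_discountedTotal_pow 1 n) fun n => ?_
  have hpull := condExp_smul (μ := P) (total a b α β (n + 1) : ℝ)
    (fun ω => Real.exp (-((a : ℝ) + b) * τ (n + 1) ω)) (ℱ n)
  have hT : (total a b α β (n + 1) : ℝ) ≠ 0 := Nat.cast_ne_zero.2 (total_pos hαβ _).ne'
  have hS : (total a b α β n : ℝ) + ((a : ℝ) + b) = total a b α β (n + 1) := by
    simpa using cast_total_add a b α β n 1
  filter_upwards [hpull, h.condExp_exp_neg_time_succ hαβ n (s := (a : ℝ) + b) (by positivity)]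
    with ω hω hω'
  refine Eq.symm (hω.trans ?_)
  rw [Pi.smul_apply, hω', hS, discountedTotal, smul_eq_mul]
  field_simp

theorem exists_limit_discountedTotal (h : IsClockedUrn P a b c d α β ℱ V τ E)
    (hαβ : (α, β) ≠ (0, 0)) :
    ∃ ξ : Ω → ℝ, Measurable ξ ∧
      (∀ᵐ ω ∂P, Tendsto (fun n => discountedTotal a b α β τ n ω) atTop (𝓝 (ξ ω))) ∧
      IsSubWeibull ξ 1 P := by
  have hM := h.martingale_discountedTotal hαβ
  have hbound (n : ℕ) : eLpNorm (discountedTotal a b α β τ n) 1 P ≤ (total a b α β 1 : ℝ≥0) := by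
    have hnorm : ∫ ω, ‖discountedTotal a b α β τ n ω‖ ∂P ≤ total a b α β 1 := by
      simpa [abs_of_nonneg (discountedTotal_nonneg n _)] using
        h.integral_discountedTotal_pow_le hαβ 1 n
    rw [eLpNorm_one_eq_lintegral_enorm,
      ← ofReal_integral_norm_eq_lintegral_enorm (hM.integrable n)]
    exact (ENNReal.ofReal_le_ofReal hnorm).trans_eq
      ((ENNReal.ofReal_natCast _).trans (ENNReal.coe_natCast _).symm)
  have hlim := hM.submartingale.ae_tendsto_limitProcess hbound
  refine ⟨_, Filtration.stronglyMeasurable_limit_process'.measurable, hlim,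
    .of_tendsto (K := Real.exp 1 * total a b α β 1) (C := 1) zero_le_one (by positivity)
      (fun N n _ => ?_) hlim⟩
  simpa using h.measureReal_lt_discountedTotal_le hαβ N.succ_ne_zero n

end IsClockedUrn

theorem exists_mem_Ico_succ_of_tendsto_atTop {u : ℕ → ℝ} (hu : Tendsto u atTop atTop) {N : ℕ}
    {t : ℝ} (hN : u N ≤ t) : ∃ n, N ≤ n ∧ t ∈ Set.Ico (u n) (u (n + 1)) := by
  by_contra! hstay
  have hle (n : ℕ) (hn : N ≤ n) : u n ≤ t := by
    induction n, hn using Nat.le_induction with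
    | base => exact hN
    | succ n hn ih => exact not_lt.1 fun hlt => hstay n hn ⟨ih, hlt⟩
  obtain ⟨n, hNn, hlt⟩ := ((eventually_ge_atTop N).and (hu.eventually_gt_atTop t)).exists
  exact hlt.not_ge (hle n hNn)

/-- Between two rings the process is constant and the discount factor is monotone, so that the
discounted process stays between its values at the two rings. -/
theorem tendsto_exp_neg_mul_of_tendsto_at_rings {m x : ℝ} (hm : 0 ≤ m) {t z : ℕ → ℝ} {f : ℝ≥0 → ℝ}
    (ht : Tendsto t atTop atTop)
    (hf : ∀ (r : ℝ≥0) (n : ℕ), t n ≤ r → (r : ℝ) < t (n + 1) → f r = z n)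
    (hleft : Tendsto (fun n => Real.exp (-m * t n) * z n) atTop (𝓝 x))
    (hright : Tendsto (fun n => Real.exp (-m * t (n + 1)) * z n) atTop (𝓝 x)) :
    Tendsto (fun r : ℝ≥0 => Real.exp (-m * r) * f r) atTop (𝓝 x) := by
  refine Metric.tendsto_nhds.2 fun ε hε => ?_
  obtain ⟨N, hN⟩ := eventually_atTop.1
    ((Metric.tendsto_nhds.1 hleft ε hε).and (Metric.tendsto_nhds.1 hright ε hε))
  filter_upwards [eventually_ge_atTop (t N).toNNReal] with r hr
  obtain ⟨n, hNn, hn, hn'⟩ :=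
    exists_mem_Ico_succ_of_tendsto_atTop ht (Real.toNNReal_le_iff_le_coe.1 hr)
  have hexp : Real.exp (-m * r) ∈ Set.Icc (Real.exp (-m * t (n + 1))) (Real.exp (-m * t n)) := by
    constructor <;> gcongr Real.exp ?_ <;> nlinarith
  have hbetween : Real.exp (-m * r) * z n ∈
      Set.uIcc (Real.exp (-m * t n) * z n) (Real.exp (-m * t (n + 1)) * z n) := by
    rcases le_total 0 (z n) with hz | hz
    · exact Set.Icc_subset_uIcc' ⟨mul_le_mul_of_nonneg_right hexp.1 hz,
        mul_le_mul_of_nonneg_right hexp.2 hz⟩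
    · exact Set.Icc_subset_uIcc ⟨mul_le_mul_of_nonpos_right hexp.2 hz,
        mul_le_mul_of_nonpos_right hexp.1 hz⟩
  rw [hf r n hn hn']
  exact (convex_ball x ε).ordConnected.uIcc_subset (hN n hNn).1 (hN n hNn).2 hbetween

section Composition

variable {a b α β : ℕ}

theorem tendsto_total_atTop (hS : 0 < (a : ℝ) + b) (α β : ℕ) :
    Tendsto (fun n => (total a b α β n : ℝ)) atTop atTop := by
  simp only [cast_total hS]
  exact (tendsto_atTop_add_const_left _ _ tendsto_natCast_atTop_atTop).atTop_mul_const hS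

theorem tendsto_natCast_div_total (hS : 0 < (a : ℝ) + b) (α β k : ℕ) :
    Tendsto (fun n : ℕ => (n : ℝ) / total a b α β (n + k)) atTop (𝓝 ((a : ℝ) + b)⁻¹) := by
  have h := (tendsto_natCast_div_add_atTop (((α : ℝ) + β) / ((a : ℝ) + b) + k)).mul_const
    ((a : ℝ) + b)⁻¹
  rw [one_mul] at h
  refine h.congr fun n => ?_
  rw [cast_total hS, ← div_eq_mul_inv, div_div, Nat.cast_add]
  ring_nf

variable {Ω : Type*} {τ : ℕ → Ω → ℝ} {ω : Ω} {x : ℝ}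

theorem tendsto_time_atTop (hS : 0 < (a : ℝ) + b)
    (hx : Tendsto (fun n => discountedTotal a b α β τ n ω) atTop (𝓝 x)) :
    Tendsto (fun n => τ n ω) atTop atTop := by
  have hexp : Tendsto (fun n => Real.exp (-((a : ℝ) + b) * τ n ω)) atTop (𝓝 0) := by
    refine (hx.div_atTop (tendsto_total_atTop hS α β)).congr' ?_
    filter_upwards [(tendsto_total_atTop hS α β).eventually_gt_atTop 0] with n hn
    rw [discountedTotal, mul_div_cancel_left₀ _ hn.ne']
  exact (tendsto_const_mul_atBot_of_neg (neg_lt_zero.2 hS)).1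
    (Real.tendsto_exp_comp_nhds_zero.1 hexp)

theorem tendsto_exp_neg_time_mul {c : ℕ} (hσ : 0 < ratio a b c) {z : ℕ → ℝ} {w : ℝ}
    (hx : Tendsto (fun n => discountedTotal a b α β τ n ω) atTop (𝓝 x))
    (hw : Tendsto (fun n : ℕ => 1 / (n : ℝ) ^ ratio a b c * z n) atTop (𝓝 w)) (k : ℕ) :
    Tendsto (fun n => Real.exp (-((a : ℝ) - c) * τ (n + k) ω) * z n) atTop
      (𝓝 ((((a : ℝ) + b)⁻¹ * x) ^ ratio a b c * w)) := by
  have hS := add_pos_of_ratio_pos hσ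
  have hbase := ((tendsto_natCast_div_total hS α β k).mul
    ((tendsto_add_atTop_iff_nat k).2 hx)).rpow_const (Or.inr hσ.le)
  refine (hbase.mul hw).congr' ?_
  filter_upwards [eventually_gt_atTop 0,
    (tendsto_add_atTop_nat k).eventually ((tendsto_total_atTop hS α β).eventually_gt_atTop 0)]
    with n hn hT
  have hn_pos : (0 : ℝ) < n := Nat.cast_pos.2 hn
  have := Real.rpow_pos_of_pos hn_pos (ratio a b c)
  have hdiscount : (n : ℝ) / total a b α β (n + k) * discountedTotal a b α β τ (n + k) ω =
      n * Real.exp (-((a : ℝ) + b) * τ (n + k) ω) := by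
    rw [discountedTotal]
    field_simp
  rw [hdiscount, Real.mul_rpow hn_pos.le (Real.exp_pos _).le, ← Real.exp_mul,
    ← ratio_mul_add hS]
  field_simp

end Composition

theorem IsContinuousTimeUrn.exists_limit_isDeterminedByMoments {Ω : Type*} [MeasurableSpace Ω]
    {P : Measure Ω} [IsProbabilityMeasure P] {a b c d α β : ℕ} {U : ℝ≥0 → Ω → ℕ × ℕ}
    (hU : IsContinuousTimeUrn P a b c d α β U) (hbalance : a + b = c + d)
    (hσ : 1 / 2 < ratio a b c) (hαβ : (α, β) ≠ (0, 0)) :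
    ∃ W : Ω → ℝ, IsContinuousTimeLimit P a b c U W ∧ IsDeterminedByMoments (P.map W) := by
  obtain ⟨ℱ, V, τ, E, h, hUV⟩ := hU
  obtain ⟨W, ⟨hWm, hWlim⟩, hW⟩ :=
    (h.isDiscreteTimeUrn hbalance hαβ).exists_limit_isSubWeibull hbalance hσ hαβ
  obtain ⟨ξ, hξm, hξlim, hξ⟩ := h.exists_limit_discountedTotal hαβ
  have hσ_pos : 0 < ratio a b c := by linarith
  have hS := add_pos_of_ratio_pos hσ_pos
  have hm : 0 ≤ (a : ℝ) - c := (ratio_mul_add hS).symm ▸ by positivity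
  have hXm : Measurable fun ω => (((a : ℝ) + b)⁻¹ * ξ ω) ^ ratio a b c * W ω :=
    ((hξm.const_mul _).pow_const _).mul hWm
  refine ⟨_, ⟨hXm, ?_⟩, ?_⟩
  · filter_upwards [hWlim, hξlim, hUV] with ω hw hx hUω
    exact tendsto_exp_neg_mul_of_tendsto_at_rings hm (tendsto_time_atTop hS hx)
      (fun t n hl hr => by rw [hUω t n hl hr])
      (tendsto_exp_neg_time_mul hσ_pos hx hw 0) (tendsto_exp_neg_time_mul hσ_pos hx hw 1)
  · have hX := ((hξ.const_mul ((a : ℝ) + b)⁻¹).rpow hσ_pos.le).mul hW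
    rw [one_mul, add_sub_cancel] at hX
    exact hX.isDeterminedByMoments_map hXm.aemeasurable

end PolyaUrn

theorem mainTheorem4_general (a b c d : ℕ) (hbalance : a + b = c + d)
    (hlarge : 1 / 2 < PolyaUrn.ratio a b c) (α β : ℕ) (hαβ : (α, β) ≠ (0, 0)) :
    (∀ {Ω : Type*} [MeasurableSpace Ω] (P : Measure Ω) [IsProbabilityMeasure P]
      (U : ℕ → Ω → ℕ × ℕ), PolyaUrn.IsDiscreteTimeUrn P a b c d α β U →
        ∃ W : Ω → ℝ, PolyaUrn.IsDiscreteTimeLimit P a b c U W ∧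
          PolyaUrn.IsDeterminedByMoments (P.map W)) ∧
    (∀ {Ω : Type*} [MeasurableSpace Ω] (P : Measure Ω) [IsProbabilityMeasure P]
      (U : ℝ≥0 → Ω → ℕ × ℕ), PolyaUrn.IsContinuousTimeUrn P a b c d α β U →
        ∃ W : Ω → ℝ, PolyaUrn.IsContinuousTimeLimit P a b c U W ∧
          PolyaUrn.IsDeterminedByMoments (P.map W)) :=
  ⟨fun _ _ _ hU => hU.exists_limit_isDeterminedByMoments hbalance hlarge hαβ,
    fun _ _ _ hU => hU.exists_limit_isDeterminedByMoments hbalance hlarge hαβ⟩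

theorem mainTheorem4 (a b c d : ℕ) (hbalance : a + b = c + d) (hb : b ≠ 0) (hc : c ≠ 0)
    (hlarge : 1 / 2 < PolyaUrn.ratio a b c) (α β : ℕ) (hαβ : (α, β) ≠ (0, 0)) :
    (∀ {Ω : Type*} [MeasurableSpace Ω] (P : Measure Ω) [IsProbabilityMeasure P]
      (U : ℕ → Ω → ℕ × ℕ), PolyaUrn.IsDiscreteTimeUrn P a b c d α β U →
        ∃ W : Ω → ℝ, PolyaUrn.IsDiscreteTimeLimit P a b c U W ∧
          PolyaUrn.IsDeterminedByMoments (P.map W)) ∧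
    (∀ {Ω : Type*} [MeasurableSpace Ω] (P : Measure Ω) [IsProbabilityMeasure P]
      (U : ℝ≥0 → Ω → ℕ × ℕ), PolyaUrn.IsContinuousTimeUrn P a b c d α β U →
        ∃ W : Ω → ℝ, PolyaUrn.IsContinuousTimeLimit P a b c U W ∧
          PolyaUrn.IsDeterminedByMoments (P.map W)) :=
  mainTheorem4_general a b c d hbalance hlarge α β hαβ
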